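/- Let $\mathcal S_0^{(3)}$ be the space of symmetric traceless real $3\times3$ matrices with the Frobenius norm $|Q|=\sqrt{\mathrm{tr}(Q^2)}$, and $A:B=A_{\alpha\beta}B_{\alpha\beta}$ (repeated indices are summed). For $a,b,c\in\mathbb R$ set $$f(Q)=aQ-b\Big[Q^2-\tfrac{\mathrm{tr}(Q^2)}{3}I_3\Big]+c\,\mathrm{tr}(Q^2)\,Q ,$$ the traceless part of the gradient of the Landau--de Gennes potential $\frac a2\mathrm{tr}(Q^2)-\frac b3\mathrm{tr}(Q^3)+\frac c4(\mathrm{tr}(Q^2))^2$. Let $\mathbf H$ be the closure in $L^2(\mathbb R^3)$ of $\{\mathbf v\in C_0^\infty(\mathbb R^3,\mathbb R^3):\ \mathrm{div}\,\mathbf v=0\}$. Given $\mathbf u_0\in\mathbf H$ and $Q_0\in H^1(\mathbb R^3,\mathcal S_0^{(3)})$, a weak solution of the co-rotational Beris--Edwards system on $\mathbb R^3\times\mathbb R_+$, $\mathbb R_+=(0,\infty)$, with initial data $(\mathbf u_0,Q_0)$ is a pair $$\mathbf u\in L^\infty_tL^2_x\cap L^2_tH^1_x(\mathbb R^3\times\mathbb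 R_+,\mathbb R^3),\qquad Q\in L^\infty_tH^1_x\cap L^2_tH^2_x(\mathbb R^3\times\mathbb R_+,\mathcal S_0^{(3)}),$$ with $\mathrm{div}\,\mathbf u=0$ a.e. such that, with $(\nabla\mathbf u)_{\alpha\beta}=\partial_\beta\mathbf u_\alpha$, $\omega=\frac12(\nabla\mathbf u-(\nabla\mathbf u)^\top)$ and $H=\Delta Q-f(Q)$, $$\int_{\mathbb R^3\times\mathbb R_+}\big[-Q:\partial_t\phi-\Delta Q:\phi-Q_{\alpha\beta}\mathbf u_\gamma\partial_\gamma\phi_{\alpha\beta}+(Q\omega-\omega Q):\phi\big]\,dx\,dt=-\int_{\mathbb R^3\times\mathbb R_+}f(Q):\phi\,dx\,dt+\int_{\mathbb R^3}Q_0:\phi(\cdot,0)\,dx$$ for all $\phi\in C_0^\infty(\mathbb R^3\times[0,\infty),\mathcal S_0^{(3)})$, and $$\int_{\mathbb R^3\times\mathbb R_+}\big[-\mathbf u\cdot\partial_t\psi+\partial_\beta\mathbf u_\alpha\partial_\beta\psi_\alpha-\mathbf u_\alpha\mathbf u_\beta\partial_\beta\psi_\alpha\big]\,dx\,dt=\int_{\mathbb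 R^3\times\mathbb R_+}\big[-\psi_\alpha\,\Delta Q:\partial_\alpha Q+(HQ-QH)_{\alpha\beta}\partial_\beta\psi_\alpha\big]\,dx\,dt+\int_{\mathbb R^3}\mathbf u_0\cdot\psi(\cdot,0)\,dx$$ for all $\psi\in C_0^\infty(\mathbb R^3\times[0,\infty),\mathbb R^3)$ with $\mathrm{div}\,\psi=0$. **Lemma.** Let $a,b\in\mathbb R$, $c>0$ and $M\ge0$. There is a constant $C>0$, depending only on $M$ and $a,b,c$, such that for all $\mathbf u_0\in\mathbf H$ and all $Q_0\in H^1(\mathbb R^3,\mathcal S_0^{(3)})\cap L^\infty(\mathbb R^3,\mathcal S_0^{(3)})$ with $\|Q_0\|_{L^\infty(\mathbb R^3)}\le M$, every weak solution $(\mathbf u,Q)$ with initial data $(\mathbf u_0,Q_0)$ satisfies $$|Q(x,t)|\le C\qquad\text{for a.e. }(x,t)\in\mathbb R^3\times\mathbb R_+ .$$ -/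

import Mathlib

open MeasureTheory Matrix
open scoped NNReal ENNReal Matrix.Norms.Frobenius

noncomputable section

namespace BerisEdwards

/-- Physical space `ℝ³` with the Euclidean norm. -/
abbrev Space : Type := EuclideanSpace ℝ (Fin 3)

/-- Space-time points `(x, t)`. -/
abbrev SpaceTime : Type := Space × ℝ

/-- `3 × 3` real matrices. With the scoped instances opened above, `‖A‖` is the Frobenius norm. -/
abbrev Mat : Type := Matrix (Fin 3) (Fin 3) ℝ

/-- The space of `Q`-tensors: symmetric traceless `3 × 3` matrices. -/
def QTensor : Set Mat := {A | Aᵀ = A ∧ A.trace = 0}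

/-- The contraction `A : B = ∑ A_{αβ} B_{αβ}`. -/
def ddot (A B : Mat) : ℝ := ∑ i, ∑ j, A i j * B i j

/-- `f_bulk` of the Landau-de Gennes potential
`(a/2) tr(Q²) - (b/3) tr(Q³) + (c/4) (tr(Q²))²`, that is, the traceless part of its gradient. -/
def fLdG (a b c : ℝ) (A : Mat) : Mat :=
  a • A - b • (A * A - ((A * A).trace / 3) • (1 : Mat)) + (c * (A * A).trace) • A

/-- The vorticity tensor `ω = (∇u - (∇u)ᵀ) / 2`, where `(∇u)_{ij} = ∂_j u_i`. -/
def vorticity (G : Mat) : Mat := (1 / 2 : ℝ) • (G - Gᵀ)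

/-- Classical partial derivative `∂_i η` on `ℝ³`. -/
def pd (i : Fin 3) (η : Space → ℝ) (x : Space) : ℝ :=
  fderiv ℝ η x (EuclideanSpace.single i 1)

/-- Classical spatial partial derivative `∂_i η` on space-time. -/
def dx (i : Fin 3) (η : SpaceTime → ℝ) (z : SpaceTime) : ℝ :=
  fderiv ℝ η z (EuclideanSpace.single i 1, 0)

/-- Classical time derivative `∂_t η` on space-time. -/
def dt (η : SpaceTime → ℝ) (z : SpaceTime) : ℝ :=
  fderiv ℝ η z (0, 1)

/-- The open space-time domain `ℝ³ × (0, ∞)`. -/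
def dom : Set SpaceTime := {z | 0 < z.2}

/-- Lebesgue measure on `ℝ³ × (0, ∞)`. -/
def domVol : Measure SpaceTime := volume.restrict dom

/-- `g` is the weak partial derivative `∂_i f` on `ℝ³`. -/
def HasWeakPd (i : Fin 3) (f g : Space → ℝ) : Prop :=
  ∀ η : Space → ℝ, ContDiff ℝ (⊤ : ℕ∞) η → HasCompactSupport η →
    ∫ x, f x * pd i η x = -∫ x, g x * η x

/-- `g` is the weak spatial partial derivative `∂_i f` on `ℝ³ × (0, ∞)`. -/
def HasWeakDx (i : Fin 3) (f g : SpaceTime → ℝ) : Prop :=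
  ∀ η : SpaceTime → ℝ, ContDiff ℝ (⊤ : ℕ∞) η → HasCompactSupport η → tsupport η ⊆ dom →
    ∫ z, f z * dx i η z ∂domVol = -∫ z, g z * η z ∂domVol

/-- For `f` measurable on `ℝ³ × (0, ∞)`: `f ∈ L^∞(0, ∞; L²(ℝ³))`. -/
def BddL2 (f : SpaceTime → ℝ) : Prop :=
  ∃ K : ℝ≥0, ∀ᵐ t : ℝ ∂(volume.restrict (Set.Ioi 0)),
    eLpNorm (fun x : Space => f (x, t)) 2 volume ≤ K

/-- The space `H`: the `L²`-closure of the smooth compactly supported divergence-free fields. -/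
def MemH (u₀ : Space → Space) : Prop :=
  MemLp u₀ 2 volume ∧
    ∀ ε : ℝ≥0, 0 < ε → ∃ v : Space → Space,
      ContDiff ℝ (⊤ : ℕ∞) v ∧ HasCompactSupport v ∧
      (∀ x, ∑ i, pd i (fun y => v y i) x = 0) ∧
      eLpNorm (fun x => u₀ x - v x) 2 volume ≤ ε

/-- The space `H¹(ℝ³)` of `Q`-tensor fields. -/
def MemH1 (Q₀ : Space → Mat) : Prop :=
  (∀ᵐ x, Q₀ x ∈ QTensor) ∧
    (∀ α β, MemLp (fun x => Q₀ x α β) 2 volume) ∧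
    ∀ i α β, ∃ g : Space → ℝ, MemLp g 2 volume ∧ HasWeakPd i (fun x => Q₀ x α β) g

/-- Test functions `C_0^∞(ℝ³ × [0, ∞))` with values in the `Q`-tensors, given as restrictions of
smooth compactly supported functions on `ℝ³ × ℝ`; they need not vanish at `t = 0`. -/
def IsTestQ (φ : SpaceTime → Mat) : Prop :=
  (∀ z, φ z ∈ QTensor) ∧ (∀ α β, ContDiff ℝ (⊤ : ℕ∞) (fun z => φ z α β)) ∧ HasCompactSupport φ

/-- Test functions `C_0^∞(ℝ³ × [0, ∞))` with values in `ℝ³` and divergence-free for `t ≥ 0`,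
given as restrictions of smooth compactly supported functions on `ℝ³ × ℝ`. -/
def IsTestU (ψ : SpaceTime → Space) : Prop :=
  ContDiff ℝ (⊤ : ℕ∞) ψ ∧ HasCompactSupport ψ ∧
    ∀ z : SpaceTime, 0 ≤ z.2 → ∑ i, dx i (fun w => ψ w i) z = 0

/-- The Laplacian, from the array of second derivatives. -/
def lap (D2Q : Fin 3 → Fin 3 → SpaceTime → Mat) (z : SpaceTime) : Mat := ∑ k, D2Q k k z

/-- `(u, Q)` is a weak solution of the co-rotational Beris-Edwards system with the
Landau-de Gennes potential and initial data `(u₀, Q₀)`, and its weak spatial derivatives are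
`(Du z) i j = ∂_j u_i`, `DQ k = ∂_k Q`, `D2Q k l = ∂_l ∂_k Q`. -/
structure WeakSolutionWith (a b c : ℝ) (u₀ : Space → Space) (Q₀ : Space → Mat)
    (u : SpaceTime → Space) (Q : SpaceTime → Mat) (Du : SpaceTime → Mat)
    (DQ : Fin 3 → SpaceTime → Mat) (D2Q : Fin 3 → Fin 3 → SpaceTime → Mat) : Prop where
  /-- `Q` is symmetric and traceless. -/
  qTensor : ∀ᵐ z ∂domVol, Q z ∈ QTensor
  /-- `u ∈ L²_t H¹_x`. -/
  u_L2 : ∀ i, MemLp (fun z => u z i) 2 domVol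
  Du_L2 : ∀ i j, MemLp (fun z => Du z i j) 2 domVol
  Du_weak : ∀ i j, HasWeakDx j (fun z => u z i) (fun z => Du z i j)
  /-- `u ∈ L^∞_t L²_x`. -/
  u_bdd : ∀ i, BddL2 (fun z => u z i)
  /-- `Q ∈ L²_t H²_x`. -/
  Q_L2 : ∀ α β, MemLp (fun z => Q z α β) 2 domVol
  DQ_L2 : ∀ k α β, MemLp (fun z => DQ k z α β) 2 domVol
  DQ_weak : ∀ k α β, HasWeakDx k (fun z => Q z α β) (fun z => DQ k z α β)
  D2Q_L2 : ∀ k l α β, MemLp (fun z => D2Q k l z α β) 2 domVol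
  D2Q_weak : ∀ k l α β, HasWeakDx l (fun z => DQ k z α β) (fun z => D2Q k l z α β)
  /-- `Q ∈ L^∞_t H¹_x`. -/
  Q_bdd : ∀ α β, BddL2 (fun z => Q z α β)
  DQ_bdd : ∀ k α β, BddL2 (fun z => DQ k z α β)
  /-- Incompressibility, `div u = 0`. -/
  div_free : ∀ᵐ z ∂domVol, ∑ i, Du z i i = 0
  /-- The weak form of
  `∂_t Q + u·∇Q - ωQ + Qω = ΔQ - f_bulk(Q)`, `Q(·, 0) = Q₀`. -/
  q_eqn : ∀ φ : SpaceTime → Mat, IsTestQ φ →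
    ∫ z, (-(∑ α, ∑ β, Q z α β * dt (fun w => φ w α β) z)
        - ddot (lap D2Q z) (φ z)
        - (∑ α, ∑ β, ∑ k, Q z α β * u z k * dx k (fun w => φ w α β) z)
        + ddot (Q z * vorticity (Du z)) (φ z)
        - ddot (vorticity (Du z) * Q z) (φ z)) ∂domVol
      = -(∫ z, ddot (fLdG a b c (Q z)) (φ z) ∂domVol) + ∫ x, ddot (Q₀ x) (φ (x, 0))
  /-- The weak form of
  `∂_t u + u·∇u + ∇P = Δu - ∇Q : ΔQ + div (Q H - H Q)`, `H = ΔQ - f_bulk(Q)`, `u(·, 0) = u₀`. -/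
  u_eqn : ∀ ψ : SpaceTime → Space, IsTestU ψ →
    ∫ z, (-(∑ i, u z i * dt (fun w => ψ w i) z)
        + (∑ i, ∑ j, Du z i j * dx j (fun w => ψ w i) z)
        - (∑ i, ∑ j, u z i * u z j * dx j (fun w => ψ w i) z)) ∂domVol
      = (∫ z, (-(∑ k, ψ z k * ddot (lap D2Q z) (DQ k z))
          + ∑ i, ∑ j, ((lap D2Q z - fLdG a b c (Q z)) * Q z
              - Q z * (lap D2Q z - fLdG a b c (Q z))) i j * dx j (fun w => ψ w i) z) ∂domVol)
        + ∫ x, ∑ i, u₀ x i * ψ (x, 0) i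

/-- `(u, Q)` is a weak solution of the co-rotational Beris-Edwards system on `ℝ³ × (0, ∞)` with
the Landau-de Gennes potential and initial data `(u₀, Q₀)`. -/
def IsWeakSolution (a b c : ℝ) (u₀ : Space → Space) (Q₀ : Space → Mat)
    (u : SpaceTime → Space) (Q : SpaceTime → Mat) : Prop :=
  ∃ (Du : SpaceTime → Mat) (DQ : Fin 3 → SpaceTime → Mat)
    (D2Q : Fin 3 → Fin 3 → SpaceTime → Mat),
    WeakSolutionWith a b c u₀ Q₀ u Q Du DQ D2Q

end BerisEdwards

end

set_option linter.unusedSectionVars false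

noncomputable section

namespace BerisEdwards

open Filter Topology Convolution ContinuousLinearMap

/-! This is a maximum principle for `|Q|`, obtained by an entropy argument on the `Q`-equation.
Contract the equation with the gradient of a smooth convex radial function of `Q` that vanishes
exactly on the ball `|Q| ≤ K`. The corotational commutator is orthogonal to `Q`. Advection by a
divergence-free field only contributes a flux. The Laplacian contributes a flux minus the Hessian of
the entropy evaluated on `∇Q`, which is nonnegative by convexity. Because `c > 0`, the quartic part
of `f(Q) : Q` dominates outside a ball of radius `1 + (|a| + |b|) / c`, so `f(Q) : Q ≥ 0` wherever
the entropy gradient is nonzero. Hence the spatial integral of the entropy cannot increase. If `K`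
also bounds the initial data it starts at zero, so it stays zero and `|Q| ≤ K` almost everywhere.

The difficulty is regularity. The products `u·∇Q` and `Qω` are only integrable, so `∂_t Q` is only a
locally integrable function and `Q` itself is not an admissible multiplier. The entropy is therefore
`softPos (√(1 + |Q|²) - r)` with `r = √(1 + K²)`. It is smooth with bounded gradient and Hessian,
and it needs no a priori bound on `Q`. Chain rules (`HasWeakDeriv.comp`,
`HasWeakDeriv.integral_mul_comp`) come from mollification and a generalized dominated convergence
theorem. The cubic part of `f(Q)` is locally integrable because `L^∞_t H¹_x` embeds locally in `L³`
(`locallyIntegrable_cube`).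

The initial condition is absorbed by continuing `Q` to negative times by `Q₀`: the weak formulation
says exactly that this continuation has no jump at `t = 0` (`WeakSolutionWith.hasWeakDeriv_extQ`).
This gives the localized inequality `WeakSolutionWith.entropy_inequality`. The entropy and its flux
are integrable on the whole domain, so the spatial cutoff can be removed, and a time cutoff that
strictly decreases up to time `T` finishes the proof in `WeakSolutionWith.norm_le`. -/

/-! ### Generalized dominated convergence -/

/-- Dominated convergence with a convergent sequence of dominating functions. -/
theorem tendsto_integral_of_le_of_tendsto_integral {α : Type*} [MeasurableSpace α] {μ : Measure α}
    {F G : ℕ → α → ℝ} {f g : α → ℝ} (hF : ∀ n, AEStronglyMeasurable (F n) μ)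
    (hG : ∀ n, Integrable (G n) μ) (hg : Integrable g μ) (hFG : ∀ n, ∀ᵐ x ∂μ, |F n x| ≤ G n x)
    (hFf : ∀ᵐ x ∂μ, Tendsto (fun n => F n x) atTop (𝓝 (f x)))
    (hGg : ∀ᵐ x ∂μ, Tendsto (fun n => G n x) atTop (𝓝 (g x)))
    (hint : Tendsto (fun n => ∫ x, G n x ∂μ) atTop (𝓝 (∫ x, g x ∂μ))) :
    Tendsto (fun n => ∫ x, F n x ∂μ) atTop (𝓝 (∫ x, f x ∂μ)) := by
  have hFG' : ∀ᵐ x ∂μ, ∀ n, |F n x| ≤ G n x := ae_all_iff.2 hFG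
  have hfg : ∀ᵐ x ∂μ, |f x| ≤ g x := by
    filter_upwards [hFG', hFf, hGg] with x h1 h2 h3
    exact le_of_tendsto_of_tendsto' h2.abs h3 h1
  have hFi : ∀ n, Integrable (F n) μ := fun n =>
    (hG n).mono' (hF n) (by simpa [Real.norm_eq_abs] using hFG n)
  -- Truncating `F n` to `[-g, g]` brings it under the ordinary dominated convergence theorem. The
  -- truncation error is at most `(G n - g)⁺ = (G n - g) + R n`. The first summand has integral
  -- tending to zero by assumption, and `R n = (g - G n)⁺` is itself dominated by `g`.
  set H : ℕ → α → ℝ := fun n x => max (-g x) (min (F n x) (g x)) with hH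
  have hHm : ∀ n, AEStronglyMeasurable (H n) μ := fun n =>
    (hg.1.neg).sup ((hF n).inf hg.1)
  have hHb : ∀ n, ∀ᵐ x ∂μ, ‖H n x‖ ≤ g x := fun n => by
    filter_upwards [hfg] with x h
    have : 0 ≤ g x := (abs_nonneg _).trans h
    rw [Real.norm_eq_abs, abs_le]
    exact ⟨le_max_left _ _, max_le (by linarith) (min_le_right _ _)⟩
  have hHi : ∀ n, Integrable (H n) μ := fun n => hg.mono' (hHm n) (hHb n)
  have hlimH : Tendsto (fun n => ∫ x, H n x ∂μ) atTop (𝓝 (∫ x, f x ∂μ)) := by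
    refine tendsto_integral_of_dominated_convergence g hHm hg hHb ?_
    filter_upwards [hfg, hFf] with x h1 h2
    have : f x = max (-g x) (min (f x) (g x)) := by
      rw [abs_le] at h1
      rw [min_eq_left h1.2, max_eq_right h1.1]
    rw [this]
    exact tendsto_const_nhds.max (h2.min tendsto_const_nhds)
  set R : ℕ → α → ℝ := fun n x => max (g x - G n x) 0 with hR
  have hRm : ∀ n, AEStronglyMeasurable (R n) μ := fun n =>
    (hg.1.sub (hG n).1).sup aestronglyMeasurable_const
  have hRb : ∀ n, ∀ᵐ x ∂μ, ‖R n x‖ ≤ g x := fun n => by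
    filter_upwards [hfg, hFG n] with x h h2
    have h3 : 0 ≤ g x := (abs_nonneg _).trans h
    have h4 : 0 ≤ G n x := (abs_nonneg _).trans h2
    rw [Real.norm_eq_abs, abs_of_nonneg (le_max_right _ _)]
    exact max_le (by linarith) h3
  have hRi : ∀ n, Integrable (R n) μ := fun n => hg.mono' (hRm n) (hRb n)
  have hlimR : Tendsto (fun n => ∫ x, R n x ∂μ) atTop (𝓝 0) := by
    have := tendsto_integral_of_dominated_convergence (f := fun _ => (0 : ℝ)) g hRm hg hRb ?_
    · simpa using this
    filter_upwards [hGg] with x h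
    have := ((tendsto_const_nhds (x := g x)).sub h).max (tendsto_const_nhds (x := (0 : ℝ)))
    simpa using this
  have key : ∀ n, |∫ x, F n x ∂μ - ∫ x, H n x ∂μ|
      ≤ (∫ x, G n x ∂μ - ∫ x, g x ∂μ) + ∫ x, R n x ∂μ := fun n => by
    have e : (∫ x, G n x ∂μ - ∫ x, g x ∂μ) + ∫ x, R n x ∂μ = ∫ x, (G n x - g x + R n x) ∂μ := by
      rw [integral_add (f := fun x => G n x - g x) ((hG n).sub hg) (hRi n),
        integral_sub (hG n) hg]
    rw [← integral_sub (hFi n) (hHi n), e]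
    refine (abs_integral_le_integral_abs).trans
      (integral_mono_ae ((hFi n).sub (hHi n)).abs (((hG n).sub hg).add (hRi n)) ?_)
    filter_upwards [hfg, hFG n] with x h h2
    have h3 : 0 ≤ g x := (abs_nonneg _).trans h
    have h4 := abs_le.1 h2
    simp only [hH, hR]
    rw [abs_le]
    rcases max_cases (-g x) (min (F n x) (g x)) with ⟨e1, e2⟩ | ⟨e1, e2⟩ <;>
    rcases min_cases (F n x) (g x) with ⟨e3, e4⟩ | ⟨e3, e4⟩ <;>
    rcases max_cases (g x - G n x) 0 with ⟨e5, e6⟩ | ⟨e5, e6⟩ <;>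
    constructor <;> linarith
  have hd : Tendsto (fun n => ∫ x, F n x ∂μ - ∫ x, H n x ∂μ) atTop (𝓝 0) := by
    refine squeeze_zero_norm key ?_
    simpa using (hint.sub_const (∫ x, g x ∂μ)).add hlimR
  simpa using hd.add hlimH

/-! ### Mollification and chain rules for weak derivatives -/

section Mollify

variable {X : Type*} [NormedAddCommGroup X] [NormedSpace ℝ X] [FiniteDimensional ℝ X]
  [MeasureSpace X] [BorelSpace X] [(volume : Measure X).IsAddHaarMeasure]
  {E : Type*} [NormedAddCommGroup E] [NormedSpace ℝ E] [CompleteSpace E]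

/-- The bump functions used for mollification. -/
def mollBump (X : Type*) [NormedAddCommGroup X] (n : ℕ) : ContDiffBump (0 : X) :=
  ⟨1 / (2 * (n + 1)), 1 / (n + 1), by positivity, by
    apply one_div_lt_one_div_of_lt <;> linarith [n.cast_nonneg (α := ℝ)]⟩

/-- The mollifying kernels. -/
def mollKer (X : Type*) [NormedAddCommGroup X] [NormedSpace ℝ X] [FiniteDimensional ℝ X]
    [MeasureSpace X] (n : ℕ) : X → ℝ :=
  (mollBump X n).normed volume

/-- Mollification of a function. -/
def moll (n : ℕ) (f : X → E) : X → E := mollKer X n ⋆[lsmul ℝ ℝ, volume] f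

theorem moll_apply (n : ℕ) (f : X → E) (z : X) :
    moll n f z = ∫ w, mollKer X n w • f (z - w) := rfl

theorem moll_apply_swap (n : ℕ) (f : X → E) (z : X) :
    moll n f z = ∫ w, mollKer X n (z - w) • f w := by
  rw [moll, convolution_eq_swap]; rfl

theorem mollKer_nonneg (n : ℕ) (z : X) : 0 ≤ mollKer X n z := ContDiffBump.nonneg_normed _ _

theorem integral_mollKer (n : ℕ) : ∫ z, mollKer X n z = 1 := ContDiffBump.integral_normed _

theorem contDiff_mollKer (n : ℕ) {m : ℕ∞} : ContDiff ℝ m (mollKer X n) :=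
  ContDiffBump.contDiff_normed _

theorem hasCompactSupport_mollKer (n : ℕ) : HasCompactSupport (mollKer X n) :=
  ContDiffBump.hasCompactSupport_normed _

/-- All kernels share the unit ball as a support bound, so one compact thickening of a test
function's support serves every `n`. -/
theorem norm_lt_one_of_mollKer_ne_zero {n : ℕ} {z : X} (h : mollKer X n z ≠ 0) : ‖z‖ < 1 := by
  have : z ∈ Function.support ((mollBump X n).normed (volume : Measure X)) := h
  rw [ContDiffBump.support_normed_eq, mem_ball_zero_iff] at this
  refine this.trans_le ?_
  change 1 / ((n : ℝ) + 1) ≤ 1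
  rw [div_le_one (by positivity)]
  linarith [n.cast_nonneg (α := ℝ)]

theorem integrable_mollKer_smul {n : ℕ} {f : X → E} (hf : LocallyIntegrable f) (z : X) :
    Integrable (fun w => mollKer X n w • f (z - w)) :=
  (hasCompactSupport_mollKer n).convolutionExists_left (lsmul ℝ ℝ)
    (contDiff_mollKer n (m := 0)).continuous hf z

theorem contDiff_moll {n : ℕ} {f : X → E} (hf : LocallyIntegrable f) {m : ℕ∞} :
    ContDiff ℝ m (moll n f) :=
  (hasCompactSupport_mollKer n).contDiff_convolution_left (lsmul ℝ ℝ) (contDiff_mollKer n) hf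

theorem ae_tendsto_moll {f : X → E} (hf : LocallyIntegrable f) :
    ∀ᵐ z, Tendsto (fun n => moll n f z) atTop (𝓝 (f z)) := by
  -- Almost everywhere convergence at Lebesgue points requires comparable inner and outer radii;
  -- here the ratio is exactly 2.
  refine ContDiffBump.ae_convolution_tendsto_right_of_locallyIntegrable (K := 2)
    (φ := fun n => mollBump X n) ?_ ?_ hf
  · exact tendsto_one_div_add_atTop_nhds_zero_nat
  · refine Eventually.of_forall fun n => le_of_eq ?_
    change 1 / ((n : ℝ) + 1) = 2 * (1 / (2 * (n + 1)))
    field_simp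

theorem norm_moll_le {n : ℕ} {f : X → E} (z : X) :
    ‖moll n f z‖ ≤ moll n (fun w => ‖f w‖) z := by
  rw [moll_apply, moll_apply]
  refine (norm_integral_le_integral_norm _).trans (le_of_eq ?_)
  simp [norm_smul, abs_of_nonneg (mollKer_nonneg _ _)]

/-- Jensen's inequality for the probability density `mollKer`, read off from the nonnegative
variance of `‖f‖` about its weighted mean `m`. -/
theorem norm_moll_sq_le {n : ℕ} {f : X → E} (hf : LocallyIntegrable f)
    (hf2 : LocallyIntegrable (fun w => ‖f w‖ ^ 2)) (z : X) :
    ‖moll n f z‖ ^ 2 ≤ moll n (fun w => ‖f w‖ ^ 2) z := by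
  set m := moll n (fun w => ‖f w‖) z with hm
  have hm0 : ‖moll n f z‖ ≤ m := norm_moll_le z
  have h1 : Integrable (fun w => mollKer X n w • ‖f (z - w)‖) := 
    integrable_mollKer_smul (fun x => (hf x).norm) z
  have h2 : Integrable (fun w => mollKer X n w • ‖f (z - w)‖ ^ 2) := integrable_mollKer_smul hf2 z
  have h3 : Integrable (mollKer X n) :=
    (contDiff_mollKer n (m := 0)).continuous.integrable_of_hasCompactSupport
      (hasCompactSupport_mollKer n)
  have h4 : 0 ≤ ∫ w, mollKer X n w * (‖f (z - w)‖ - m) ^ 2 :=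
    integral_nonneg fun w => mul_nonneg (mollKer_nonneg _ _) (sq_nonneg _)
  have h5 : ∫ w, mollKer X n w * (‖f (z - w)‖ - m) ^ 2
      = moll n (fun w => ‖f w‖ ^ 2) z - 2 * m * m + m ^ 2 := by
    have : (fun w => mollKer X n w * (‖f (z - w)‖ - m) ^ 2) = fun w =>
        (mollKer X n w • ‖f (z - w)‖ ^ 2 - (2 * m) * (mollKer X n w • ‖f (z - w)‖))
          + m ^ 2 * mollKer X n w := by
      ext w; simp only [smul_eq_mul]; ring
    have h6 : Integrable (fun w => mollKer X n w • ‖f (z - w)‖ ^ 2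
        - (2 * m) * (mollKer X n w • ‖f (z - w)‖)) := h2.sub (h1.const_mul _)
    rw [this, integral_add h6 (h3.const_mul _),
      integral_sub h2 (h1.const_mul _), integral_const_mul, integral_const_mul, integral_mollKer]
    simp [moll_apply, hm]
  nlinarith [norm_nonneg (moll n f z)]

theorem integrable_moll {n : ℕ} {f : X → E} (hf : Integrable f) : Integrable (moll n f) :=
  ((contDiff_mollKer n (m := 0)).continuous.integrable_of_hasCompactSupport
      (hasCompactSupport_mollKer n)).integrable_convolution (lsmul ℝ ℝ) hf

/-- Mollification preserves mass. Mollified dominating functions therefore have constant integral,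
and the convergence hypothesis of the generalized dominated convergence theorem is automatic. -/
theorem integral_moll {n : ℕ} {f : X → E} (hf : Integrable f) : ∫ z, moll n f z = ∫ z, f z := by
  rw [moll, integral_convolution (lsmul ℝ ℝ)
    ((contDiff_mollKer n (m := 0)).continuous.integrable_of_hasCompactSupport
      (hasCompactSupport_mollKer n)) hf, integral_mollKer]
  simp

/-- Mollification at `z` only sees values at distance less than one. -/
theorem moll_congr {n : ℕ} {f g : X → E} {z : X} (h : ∀ w, ‖z - w‖ < 1 → f w = g w) :
    moll n f z = moll n g z := by
  rw [moll_apply_swap, moll_apply_swap]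
  congr 1 with w
  by_cases hw : mollKer X n (z - w) = 0
  · simp [hw]
  · rw [h w (norm_lt_one_of_mollKer_ne_zero hw)]

theorem moll_congr_ae {n : ℕ} {f g : X → E} (h : f =ᵐ[volume] g) : moll n f = moll n g := by
  ext z
  rw [moll_apply_swap, moll_apply_swap]
  refine integral_congr_ae ?_
  filter_upwards [h] with w hw
  rw [hw]

/-- `g` is the weak derivative of `f` in the direction `v`. -/
def HasWeakDeriv (v : X) (f g : X → E) : Prop :=
  ∀ η : X → ℝ, ContDiff ℝ (⊤ : ℕ∞) η → HasCompactSupport η →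
    ∫ z, fderiv ℝ η z v • f z = -∫ z, η z • g z

theorem fderiv_comp_const_sub_apply {f : X → E} {z w : X} (hf : DifferentiableAt ℝ f (z - w))
    (v : X) : fderiv ℝ (fun w => f (z - w)) w v = -fderiv ℝ f (z - w) v := by
  have h : HasFDerivAt (fun w => f (z - w))
      ((fderiv ℝ f (z - w)).comp (-ContinuousLinearMap.id ℝ X)) w :=
    HasFDerivAt.comp w hf.hasFDerivAt ((hasFDerivAt_id w).const_sub z)
  rw [h.fderiv]
  simp

/-- Differentiate the kernel under the convolution; the reflected translate `w ↦ mollKer X n (z -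
w)` is then itself an admissible test function for the weak derivative. -/
theorem HasWeakDeriv.fderiv_moll {v : X} {f g : X → E} (h : HasWeakDeriv v f g)
    (hf : LocallyIntegrable f) (n : ℕ) (z : X) :
    fderiv ℝ (moll n f) z v = moll n g z := by
  have hc : HasCompactSupport (fderiv ℝ (mollKer X n)) := (hasCompactSupport_mollKer n).fderiv ℝ
  have hcont : Continuous (fderiv ℝ (mollKer X n)) :=
    (contDiff_mollKer n (m := 1)).continuous_fderiv (by simp)
  have hex := hc.convolutionExists_left ((lsmul ℝ ℝ : ℝ →L[ℝ] E →L[ℝ] E).precompL X)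
    (μ := volume) hcont hf z
  have h2 : (fderiv ℝ (mollKer X n) ⋆[(lsmul ℝ ℝ : ℝ →L[ℝ] E →L[ℝ] E).precompL X, volume] f) z v
      = ∫ w, fderiv ℝ (mollKer X n) w v • f (z - w) := by
    rw [convolution_def, ContinuousLinearMap.integral_apply hex]
    rfl
  have h1 : HasFDerivAt (moll n f) _ z := (hasCompactSupport_mollKer n).hasFDerivAt_convolution_left
    (lsmul ℝ ℝ) (contDiff_mollKer (X := X) n (m := 1)) hf z
  rw [h1.fderiv, h2, ← integral_sub_left_eq_self _ _ z, moll_apply_swap]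
  have hη : ContDiff ℝ (⊤ : ℕ∞) (fun w => mollKer X n (z - w)) :=
    (contDiff_mollKer n).comp (contDiff_const.sub contDiff_id)
  have hηc : HasCompactSupport (fun w => mollKer X n (z - w)) :=
    (hasCompactSupport_mollKer n).comp_homeomorph (Homeomorph.subLeft z)
  have h3 := h _ hη hηc
  have h4 : ∀ w, fderiv ℝ (fun w => mollKer X n (z - w)) w v
      = - fderiv ℝ (mollKer X n) (z - w) v := fun w => fderiv_comp_const_sub_apply
        ((contDiff_mollKer n (m := 1)).differentiable (by simp) _) v
  simp only [h4, neg_smul, integral_neg, neg_inj] at h3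
  simpa using h3

/-- Dominated convergence with mollified dominating functions. -/
theorem tendsto_integral_of_le_moll {T : ℕ → X → ℝ} {S k h : X → ℝ}
    (hT : ∀ n, AEStronglyMeasurable (T n)) (hk : Integrable k) (hh : Integrable h)
    (hle : ∀ n, ∀ z, |T n z| ≤ k z + moll n h z)
    (hlim : ∀ᵐ z, Tendsto (fun n => T n z) atTop (𝓝 (S z))) :
    Tendsto (fun n => ∫ z, T n z) atTop (𝓝 (∫ z, S z)) := by
  refine tendsto_integral_of_le_of_tendsto_integral (G := fun n z => k z + moll n h z)
    (g := fun z => k z + h z) hT (fun n => hk.add (integrable_moll hh)) (hk.add hh)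
    (fun n => Eventually.of_forall (hle n)) hlim ?_ ?_
  · filter_upwards [ae_tendsto_moll hh.locallyIntegrable] with z hz
    exact hz.const_add _
  · refine tendsto_const_nhds.congr fun n => ?_
    rw [integral_add hk hh, integral_add hk (integrable_moll hh), integral_moll hh]

theorem abs_le_of_norm_fderiv_le {G : E → ℝ} (hG : ContDiff ℝ (⊤ : ℕ∞) G) (hG0 : G 0 = 0) {C : ℝ}
    (hC : ∀ A, ‖fderiv ℝ G A‖ ≤ C) (A : E) : |G A| ≤ C * ‖A‖ := by
  have := Convex.norm_image_sub_le_of_norm_fderiv_le (𝕜 := ℝ) (f := G) (s := Set.univ) (x := 0)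
    (y := A) (fun x _ => hG.differentiable (by simp) x) (fun x _ => hC x) convex_univ
    (Set.mem_univ _) (Set.mem_univ _)
  simpa [hG0] using this

theorem exists_norm_le_of_contDiff {η : X → ℝ} (hη : ContDiff ℝ (⊤ : ℕ∞) η)
    (hηc : HasCompactSupport η) (v : X) :
    ∃ B : ℝ, 0 ≤ B ∧ (∀ z, |η z| ≤ B) ∧ ∀ z, |fderiv ℝ η z v| ≤ B := by
  obtain ⟨B, hB⟩ := hη.continuous.bounded_above_of_compact_support hηc
  obtain ⟨B', hB'⟩ := ((hη.continuous_fderiv (by simp)).clm_apply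
    (continuous_const (y := v))).bounded_above_of_compact_support (hηc.fderiv_apply ℝ v)
  exact ⟨max B B', (norm_nonneg _).trans ((hB 0).trans (le_max_left _ _)),
    fun z => (hB z).trans (le_max_left _ _), fun z => (hB' z).trans (le_max_right _ _)⟩

theorem tendsto_fderiv_apply {G : E → ℝ} (hG : ContDiff ℝ (⊤ : ℕ∞) G) {a d : ℕ → E} {A D : E}
    (ha : Tendsto a atTop (𝓝 A)) (hd : Tendsto d atTop (𝓝 D)) :
    Tendsto (fun n => fderiv ℝ G (a n) (d n)) atTop (𝓝 (fderiv ℝ G A D)) := by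
  have hc : Continuous (fun p : E × E => fderiv ℝ G p.1 p.2) :=
    ((hG.continuous_fderiv (by simp)).comp continuous_fst).clm_apply continuous_snd
  exact (hc.tendsto (A, D)).comp (ha.prodMk_nhds hd)

theorem contDiff_comp_moll {f : X → E} (hf : LocallyIntegrable f) {G : E → ℝ}
    (hG : ContDiff ℝ (⊤ : ℕ∞) G) (n : ℕ) : ContDiff ℝ (⊤ : ℕ∞) (fun z => G (moll n f z)) :=
  hG.comp (contDiff_moll hf)

theorem HasWeakDeriv.fderiv_comp_moll {v : X} {f g : X → E} (h : HasWeakDeriv v f g)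
    (hf : LocallyIntegrable f) {G : E → ℝ} (hG : ContDiff ℝ (⊤ : ℕ∞) G) (n : ℕ) (z : X) :
    fderiv ℝ (fun z => G (moll n f z)) z v = fderiv ℝ G (moll n f z) (moll n g z) := by
  rw [← h.fderiv_moll hf]
  have h1 : HasFDerivAt G (fderiv ℝ G (moll n f z)) (moll n f z) :=
    (hG.differentiable (by simp) _).hasFDerivAt
  have h2 : HasFDerivAt (moll n f) (fderiv ℝ (moll n f) z) z :=
    ((contDiff_moll hf (m := 1)).differentiable (by simp) _).hasFDerivAt
  have h3 : HasFDerivAt (fun z => G (moll n f z)) _ z := h1.comp z h2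
  rw [h3.fderiv]
  rfl

/-- Localization: on `K`, a locally integrable function may be replaced by its restriction to a
compact neighbourhood of `K`, which is integrable when `K` is compact. Its mollification can then
serve as a dominating function. -/
theorem moll_indicator_cthickening {K : Set X} {f : X → E} {z : X} (hz : z ∈ K) (n : ℕ) :
    moll n ((Metric.cthickening 1 K).indicator f) z = moll n f z := by
  refine moll_congr fun w hw => Set.indicator_of_mem ?_ _
  refine Metric.mem_cthickening_of_dist_le w z 1 K hz ?_
  rw [dist_comm, dist_eq_norm]
  exact hw.le

theorem moll_const_mul (n : ℕ) (c : ℝ) (f : X → ℝ) (z : X) :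
    moll n (fun w => c * f w) z = c * moll n f z := by
  rw [moll_apply, moll_apply, ← integral_const_mul]
  congr 1 with w
  simp only [smul_eq_mul]; ring

/-- Chain rule for weak derivatives. -/
theorem HasWeakDeriv.comp {v : X} {f g : X → E} (h : HasWeakDeriv v f g)
    (hf : LocallyIntegrable f) (hg : LocallyIntegrable g) {G : E → ℝ}
    (hG : ContDiff ℝ (⊤ : ℕ∞) G) (hG0 : G 0 = 0) {C : ℝ} (hC : ∀ A, ‖fderiv ℝ G A‖ ≤ C) :
    HasWeakDeriv v (fun z => G (f z)) (fun z => fderiv ℝ G (f z) (g z)) := by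
  intro η hη hηc
  obtain ⟨B, hB0, hB1, hB2⟩ := exists_norm_le_of_contDiff hη hηc v
  have hC0 : 0 ≤ C := (norm_nonneg _).trans (hC 0)
  -- Both sides are approximated by the classical identity for `G ∘ moll n f`. Since `f` and `g` are
  -- only locally integrable, the dominating functions are mollifications of their restrictions to
  -- `K`.
  set K := Metric.cthickening 1 (tsupport η) with hK
  have hKc : IsCompact K := hηc.cthickening
  have hi : ∀ {u : X → E}, LocallyIntegrable u → Integrable (fun z => B * C * ‖K.indicator u z‖) :=
    fun {u} hu => (((integrable_indicator_iff hKc.measurableSet).2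
      (hu.integrableOn_isCompact hKc)).norm).const_mul _
  have hb : ∀ {u : X → E} (n : ℕ) (z : X), z ∈ tsupport η →
      B * C * ‖moll n u z‖ ≤ 0 + moll n (fun z => B * C * ‖K.indicator u z‖) z :=
    fun {u} n z hz => by
      rw [zero_add, moll_const_mul, ← moll_indicator_cthickening hz]
      exact mul_le_mul_of_nonneg_left (norm_moll_le z) (by positivity)
  have hpos : ∀ {u : X → E} (n : ℕ) (z : X),
      0 ≤ 0 + moll n (fun z => B * C * ‖K.indicator u z‖) z := fun {u} n z => by
    rw [zero_add, moll_apply]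
    exact integral_nonneg fun w => mul_nonneg (mollKer_nonneg _ _) (by positivity)
  have hcd := fun n => contDiff_comp_moll hf hG n
  have hGc : Continuous (fderiv ℝ G) := hG.continuous_fderiv (by simp)
  have lim1 : Tendsto (fun n => ∫ z, fderiv ℝ η z v • G (moll n f z)) atTop
      (𝓝 (∫ z, fderiv ℝ η z v • G (f z))) := by
    refine tendsto_integral_of_le_moll (k := fun _ => 0) (fun n => ?_) (integrable_zero _ _ _)
      (hi hf) (fun n z => ?_) ?_
    · exact (((hη.continuous_fderiv (by simp)).clm_apply continuous_const).smul
        (hcd n).continuous).aestronglyMeasurable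
    · by_cases hz : z ∈ tsupport η
      · refine le_trans ?_ (hb n z hz)
        rw [smul_eq_mul, abs_mul, mul_assoc]
        exact mul_le_mul (hB2 z) (abs_le_of_norm_fderiv_le hG hG0 hC _) (abs_nonneg _) hB0
      · have : fderiv ℝ η z = 0 := by
          by_contra hne
          exact hz (support_fderiv_subset ℝ hne)
        simpa [this] using hpos (u := f) n z
    · filter_upwards [ae_tendsto_moll hf] with z hz
      exact ((hG.continuous.tendsto _).comp hz).const_smul _
  have lim2 : Tendsto (fun n => ∫ z, η z • fderiv ℝ G (moll n f z) (moll n g z)) atTop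
      (𝓝 (∫ z, η z • fderiv ℝ G (f z) (g z))) := by
    refine tendsto_integral_of_le_moll (k := fun _ => 0) (fun n => ?_) (integrable_zero _ _ _)
      (hi hg) (fun n z => ?_) ?_
    · exact (hη.continuous.smul ((hGc.comp (contDiff_moll hf (m := 0)).continuous).clm_apply
        (contDiff_moll hg (m := 0)).continuous)).aestronglyMeasurable
    · by_cases hz : z ∈ tsupport η
      · refine le_trans ?_ (hb n z hz)
        rw [smul_eq_mul, abs_mul, mul_assoc]
        exact mul_le_mul (hB1 z) (((fderiv ℝ G _).le_opNorm _).trans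
          (mul_le_mul_of_nonneg_right (hC _) (norm_nonneg _))) (abs_nonneg _) hB0
      · simpa [image_eq_zero_of_notMem_tsupport hz] using hpos (u := g) n z
    · filter_upwards [ae_tendsto_moll hf, ae_tendsto_moll hg] with z hz hz'
      exact (tendsto_fderiv_apply hG hz hz').const_smul _
  refine tendsto_nhds_unique lim1 (lim2.neg.congr fun n => ?_)
  have h2 : ∀ z, fderiv ℝ G (moll n f z) (moll n g z)
      = fderiv ℝ (fun z => G (moll n f z)) z v := fun z => (h.fderiv_comp_moll hf hG n z).symm
  simp only [h2, smul_eq_mul]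
  have c1 : Continuous (fun z => fderiv ℝ η z v) :=
    (hη.continuous_fderiv (by simp)).clm_apply continuous_const
  have c2 : Continuous (fun z => fderiv ℝ (fun z => G (moll n f z)) z v) :=
    ((hcd n).continuous_fderiv (by simp)).clm_apply continuous_const
  have := integral_mul_fderiv_eq_neg_fderiv_mul_of_integrable (μ := (volume : Measure X)) (𝕜 := ℝ)
    (f := η) (g := fun z => G (moll n f z)) (v := v)
    ((c1.mul (hcd n).continuous).integrable_of_hasCompactSupport
      ((hηc.fderiv_apply ℝ v).mul_right))
    ((hη.continuous.mul c2).integrable_of_hasCompactSupport hηc.mul_right)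
    ((hη.continuous.mul (hcd n).continuous).integrable_of_hasCompactSupport hηc.mul_right)
    (fun x _ => hη.differentiable (by simp) x)
    (fun x _ => (hcd n).differentiable (by simp) x)
  rw [this, neg_neg]

/-- Integration by parts against a smooth function of a function with square integrable weak
derivative. -/
theorem HasWeakDeriv.integral_mul_comp {v : X} {w w' : X → ℝ} (hww : HasWeakDeriv v w w')
    (hw : MemLp w 2) (hw' : MemLp w' 2) {f g : X → E} (h : HasWeakDeriv v f g)
    (hf : MemLp f 2) (hg : MemLp g 2) {G : E → ℝ}
    (hG : ContDiff ℝ (⊤ : ℕ∞) G) (hG0 : G 0 = 0) {C : ℝ} (hC : ∀ A, ‖fderiv ℝ G A‖ ≤ C)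
    {η : X → ℝ} (hη : ContDiff ℝ (⊤ : ℕ∞) η) (hηc : HasCompactSupport η) :
    ∫ z, w' z * (G (f z) * η z)
      = -∫ z, w z * (fderiv ℝ G (f z) (g z) * η z + G (f z) * fderiv ℝ η z v) := by
  obtain ⟨B, hB0, hB1, hB2⟩ := exists_norm_le_of_contDiff hη hηc v
  have hC0 : 0 ≤ C := (norm_nonneg _).trans (hC 0)
  have hfl : LocallyIntegrable f := hf.locallyIntegrable (by norm_num)
  have hgl : LocallyIntegrable g := hg.locallyIntegrable (by norm_num)
  have hf2 : Integrable (fun z => ‖f z‖ ^ 2) := hf.integrable_norm_pow two_ne_zero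
  have hg2 : Integrable (fun z => ‖g z‖ ^ 2) := hg.integrable_norm_pow two_ne_zero
  have hw2 : Integrable (fun z => w z ^ 2) := hw.integrable_sq
  have hw2' : Integrable (fun z => w' z ^ 2) := hw'.integrable_sq
  have hcd := fun n => contDiff_comp_moll hfl hG n
  have hGc : Continuous (fderiv ℝ G) := hG.continuous_fderiv (by simp)
  have c1 : Continuous (fun z => fderiv ℝ η z v) :=
    (hη.continuous_fderiv (by simp)).clm_apply continuous_const
  -- Young's inequality followed by Jensen's. The squares of all the functions are integrable, so
  -- products are dominated by a fixed integrable function plus a mollified one.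
  have hbd : ∀ {u : X → E} (n : ℕ) (z : X), LocallyIntegrable u →
      LocallyIntegrable (fun z => ‖u z‖ ^ 2) → ∀ {x y b : ℝ}, |y| ≤ C * ‖moll n u z‖ → |b| ≤ B →
      |x * (y * b)| ≤ B * C * (x ^ 2 + moll n (fun z => ‖u z‖ ^ 2) z) := by
    intro u n z hu hu2 x y b hy hb
    have h1 := norm_moll_sq_le (n := n) hu hu2 z
    have h2 : |y| * |b| ≤ (C * ‖moll n u z‖) * B :=
      mul_le_mul hy hb (abs_nonneg _) (by positivity)
    have h3 : |x| * ‖moll n u z‖ ≤ x ^ 2 + ‖moll n u z‖ ^ 2 := by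
      nlinarith [sq_nonneg (|x| - ‖moll n u z‖), sq_abs x, abs_nonneg x,
        norm_nonneg (moll n u z), mul_nonneg (abs_nonneg x) (norm_nonneg (moll n u z))]
    calc |x * (y * b)| = |x| * (|y| * |b|) := by rw [abs_mul, abs_mul]
      _ ≤ |x| * ((C * ‖moll n u z‖) * B) := mul_le_mul_of_nonneg_left h2 (abs_nonneg _)
      _ = B * C * (|x| * ‖moll n u z‖) := by ring
      _ ≤ B * C * (x ^ 2 + moll n (fun z => ‖u z‖ ^ 2) z) :=
        mul_le_mul_of_nonneg_left (by linarith) (by positivity)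
  have hdG : ∀ A D : E, |fderiv ℝ G A D| ≤ C * ‖D‖ := fun A D =>
    ((fderiv ℝ G A).le_opNorm _).trans (mul_le_mul_of_nonneg_right (hC _) (norm_nonneg _))
  have cf := fun n => (contDiff_moll (n := n) hfl (m := 0)).continuous
  have cg := fun n => (contDiff_moll (n := n) hgl (m := 0)).continuous
  have lim1 : Tendsto (fun n => ∫ z, w' z * (G (moll n f z) * η z)) atTop
      (𝓝 (∫ z, w' z * (G (f z) * η z))) := by
    refine tendsto_integral_of_le_moll (fun n => ?_) (hw2'.const_mul (B * C))
      (hf2.const_mul (B * C)) (fun n z => ?_) ?_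
    · exact hw'.1.mul ((hcd n).continuous.mul hη.continuous).aestronglyMeasurable
    · rw [moll_const_mul, ← mul_add]
      exact hbd n z hfl hf2.locallyIntegrable (abs_le_of_norm_fderiv_le hG hG0 hC _) (hB1 z)
    · filter_upwards [ae_tendsto_moll hfl] with z hz
      exact (((hG.continuous.tendsto _).comp hz).mul_const _).const_mul _
  have lim2 : Tendsto (fun n => ∫ z, w z * (fderiv ℝ G (moll n f z) (moll n g z) * η z
        + G (moll n f z) * fderiv ℝ η z v)) atTop
      (𝓝 (∫ z, w z * (fderiv ℝ G (f z) (g z) * η z + G (f z) * fderiv ℝ η z v))) := by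
    refine tendsto_integral_of_le_moll (fun n => ?_) (hw2.const_mul (2 * (B * C)))
      ((hg2.add hf2).const_mul (B * C)) (fun n z => ?_) ?_
    · exact hw.1.mul ((((hGc.comp (cf n)).clm_apply (cg n)).mul hη.continuous).add
        ((hcd n).continuous.mul c1)).aestronglyMeasurable
    · rw [moll_const_mul]
      have e : moll n ((fun z => ‖g z‖ ^ 2) + fun z => ‖f z‖ ^ 2) z
          = moll n (fun z => ‖g z‖ ^ 2) z + moll n (fun z => ‖f z‖ ^ 2) z := by
        rw [moll_apply, moll_apply, moll_apply, ← integral_add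
          (integrable_mollKer_smul hg2.locallyIntegrable z)
          (integrable_mollKer_smul hf2.locallyIntegrable z)]
        simp [mul_add]
      rw [e, mul_add (w z)]
      refine (abs_add_le _ _).trans ?_
      have b1 := hbd n z (x := w z) hgl hg2.locallyIntegrable
        (hdG (moll n f z) (moll n g z)) (hB1 z)
      have b2 := hbd n z (x := w z) hfl hf2.locallyIntegrable
        (abs_le_of_norm_fderiv_le hG hG0 hC _) (hB2 z)
      linarith
    · filter_upwards [ae_tendsto_moll hfl, ae_tendsto_moll hgl] with z hz hz'
      exact (((tendsto_fderiv_apply hG hz hz').mul_const _).add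
        (((hG.continuous.tendsto _).comp hz).mul_const _)).const_mul _
  refine tendsto_nhds_unique lim1 (lim2.neg.congr fun n => ?_)
  -- After mollification the multiplier is smooth with compact support, so the definition of the
  -- weak derivative of `w` applies to it directly.
  have h3 := hww (fun z => G (moll n f z) * η z) ((hcd n).mul hη) hηc.mul_left
  have h4 : ∀ z, fderiv ℝ (fun z => G (moll n f z) * η z) z v
      = fderiv ℝ G (moll n f z) (moll n g z) * η z + G (moll n f z) * fderiv ℝ η z v := fun z => by
    rw [fderiv_fun_mul ((hcd n).differentiable (by simp) z) (hη.differentiable (by simp) z),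
      ← h.fderiv_comp_moll hfl hG n z]
    simp; ring
  simp only [h4, smul_eq_mul] at h3
  rw [show (fun z => w' z * (G (moll n f z) * η z)) = fun z => G (moll n f z) * η z * w' z from
    funext fun z => mul_comm _ _, ← neg_eq_iff_eq_neg.2 h3, neg_inj]
  congr 1 with z
  ring

end Mollify

/-! ### Extension by zero across the initial time -/

theorem measurableSet_dom : MeasurableSet dom := measurableSet_lt measurable_const measurable_snd

/-- The direction `e_i` in space-time. -/
abbrev eX (i : Fin 3) : SpaceTime := (EuclideanSpace.single i 1, 0)

theorem integrable_mul_of_hasCompactSupport {X : Type*} [TopologicalSpace X] [T2Space X]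
    [MeasurableSpace X] [OpensMeasurableSpace X] {μ : Measure X} [IsFiniteMeasureOnCompacts μ]
    {f θ : X → ℝ} (hf : MemLp f 2 μ) (hθ : Continuous θ) (hθc : HasCompactSupport θ) :
    Integrable (fun z => f z * θ z) μ :=
  MemLp.integrable_mul (p := 2) (q := 2) hf (hθ.memLp_of_hasCompactSupport hθc)

instance : IsFiniteMeasureOnCompacts domVol := by unfold domVol; infer_instance

/-- The extension by zero of a weak spatial derivative. -/
theorem HasWeakDx.hasWeakDeriv {i : Fin 3} {f g : SpaceTime → ℝ} (h : HasWeakDx i f g)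
    (hf : MemLp f 2 domVol) (hg : MemLp g 2 domVol) :
    HasWeakDeriv (eX i) (dom.indicator f) (dom.indicator g) := by
  intro η hη hηc
  have c1 : Continuous (fun z => fderiv ℝ η z (eX i)) :=
    (hη.continuous_fderiv (by simp)).clm_apply continuous_const
  -- These cutoffs vanish for `n t ≤ 1` and equal 1 for `n t ≥ 2`, which makes `χ n * η` admissible
  -- on the open domain. They depend on time only, so a spatial derivative never hits them and no
  -- boundary term at `t = 0` survives the limit.
  set χ : ℕ → SpaceTime → ℝ := fun n z => Real.smoothTransition (n * z.2 - 1) with hχ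
  have hχc : ∀ n, ContDiff ℝ (⊤ : ℕ∞) (χ n) := fun n =>
    Real.smoothTransition.contDiff.comp ((contDiff_const.mul contDiff_snd).sub contDiff_const)
  have hχ1 : ∀ n z, ‖χ n z‖ ≤ 1 := fun n z => by
    rw [Real.norm_eq_abs, abs_of_nonneg (Real.smoothTransition.nonneg _)]
    exact Real.smoothTransition.le_one _
  have hχl : ∀ z ∈ dom, Tendsto (fun n => χ n z) atTop (𝓝 1) := fun z hz => by
    refine tendsto_const_nhds.congr' ?_
    obtain ⟨N, hN⟩ := exists_nat_gt (2 / z.2)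
    filter_upwards [eventually_ge_atTop N] with n hn
    have hz : 0 < z.2 := hz
    have : (2 : ℝ) ≤ n * z.2 := by
      rw [div_lt_iff₀ hz] at hN
      have : (N : ℝ) * z.2 ≤ n * z.2 := by gcongr
      linarith
    exact (Real.smoothTransition.one_of_one_le (by linarith)).symm
  have hχd : ∀ n z, fderiv ℝ (χ n) z (eX i) = 0 := fun n z => by
    have h1 : HasFDerivAt (fun z : SpaceTime => (n : ℝ) * z.2 - 1)
        ((n : ℝ) • ContinuousLinearMap.snd ℝ Space ℝ) z :=
      (hasFDerivAt_snd.const_mul (n : ℝ)).sub_const 1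
    have h2 := ((Real.smoothTransition.contDiff (n := 1)).differentiable
      (by simp) ((n : ℝ) * z.2 - 1)).hasFDerivAt
    have h3 : HasFDerivAt (χ n) ((fderiv ℝ Real.smoothTransition (n * z.2 - 1)).comp
        ((n : ℝ) • ContinuousLinearMap.snd ℝ Space ℝ)) z :=
      HasFDerivAt.comp (g := Real.smoothTransition) z h2 h1
    rw [h3.fderiv]
    simp
  have hsupp : ∀ n, tsupport (fun z => χ n z * η z) ⊆ dom := fun n => by
    have hcl : IsClosed {z : SpaceTime | 1 ≤ (n : ℝ) * z.2} :=
      isClosed_le continuous_const (continuous_const.mul continuous_snd)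
    refine (closure_minimal (fun z hz => ?_) hcl).trans fun z (hz : 1 ≤ (n : ℝ) * z.2) => ?_
    · by_contra hlt
      refine hz ?_
      simp only [Set.mem_ofPred_eq, not_le] at hlt
      simp [hχ, Real.smoothTransition.zero_of_nonpos (show (n : ℝ) * z.2 - 1 ≤ 0 by linarith)]
    · change 0 < z.2
      by_contra hneg
      nlinarith [n.cast_nonneg (α := ℝ)]
  have key : ∀ n, ∫ z, χ n z * (f z * fderiv ℝ η z (eX i)) ∂domVol
      = -∫ z, χ n z * (g z * η z) ∂domVol := fun n => by
    have := h (fun z => χ n z * η z) ((hχc n).mul hη) hηc.mul_left (hsupp n)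
    rw [show (fun z => χ n z * (g z * η z)) = fun z => g z * (χ n z * η z) by ext z; ring, ← this]
    congr 1 with z
    rw [dx, fderiv_fun_mul ((hχc n).differentiable (by simp) z) (hη.differentiable (by simp) z)]
    simp only [_root_.add_apply, _root_.smul_apply, hχd, smul_eq_mul]
    ring
  have lim : ∀ {F : SpaceTime → ℝ}, Integrable F domVol →
      Tendsto (fun n => ∫ z, χ n z * F z ∂domVol) atTop (𝓝 (∫ z, F z ∂domVol)) := fun {F} hF => by
    refine tendsto_integral_of_dominated_convergence (fun z => ‖F z‖)
      (fun n => (hχc n).continuous.aestronglyMeasurable.mul hF.1) hF.norm (fun n => ?_) ?_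
    · refine Eventually.of_forall fun z => ?_
      rw [norm_mul]
      exact mul_le_of_le_one_left (norm_nonneg _) (hχ1 n z)
    · filter_upwards [ae_restrict_mem measurableSet_dom] with z hz
      simpa using (hχl z hz).mul_const (F z)
  have lim1 := lim (integrable_mul_of_hasCompactSupport hf c1 (hηc.fderiv_apply ℝ (eX i)))
  have lim2 := lim (integrable_mul_of_hasCompactSupport hg hη.continuous hηc)
  have := tendsto_nhds_unique lim1 (lim2.neg.congr fun n => (key n).symm)
  rw [domVol, ← integral_indicator measurableSet_dom, ← integral_indicator measurableSet_dom] at this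
  convert! this using 2
  · ext z; by_cases hz : z ∈ dom <;> simp [hz, mul_comm]
  · congr 1 with z; by_cases hz : z ∈ dom <;> simp [hz, mul_comm]

/-! ### Matrices with the Frobenius norm as a Euclidean space -/

/-- `3 × 3` matrices as a Euclidean space. -/
abbrev VMat : Type := EuclideanSpace ℝ (Fin 3 × Fin 3)

/-- The identification of matrices with vectors. -/
def toV (A : Mat) : VMat := WithLp.toLp 2 (fun p => A p.1 p.2)

theorem toV_apply (A : Mat) (p : Fin 3 × Fin 3) : toV A p = A p.1 p.2 := rfl

theorem inner_toV (A B : Mat) : inner ℝ (toV A) (toV B) = ddot A B := by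
  simp [PiLp.inner_apply, toV_apply, ddot, Fintype.sum_prod_type, mul_comm]

theorem norm_toV (A : Mat) : ‖toV A‖ = ‖A‖ := by
  rw [EuclideanSpace.norm_eq, Matrix.frobenius_norm_def, Real.sqrt_eq_rpow, Fintype.sum_prod_type]
  simp [toV_apply]

theorem toV_zero : toV 0 = 0 := by ext p; simp [toV_apply]

theorem norm_sq_eq_ddot (A : Mat) : ‖A‖ ^ 2 = ddot A A := by
  rw [← norm_toV, ← inner_toV, real_inner_self_eq_norm_sq]

theorem memLp_toV {α : Type*} [MeasurableSpace α] {μ : Measure α} {p : ℝ≥0∞} {F : α → Mat}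
    (h : ∀ i j, MemLp (fun z => F z i j) p μ) : MemLp (fun z => toV (F z)) p μ :=
  MemLp.of_eval_piLp fun q => h q.1 q.2

theorem locallyIntegrable_toV {X : Type*} [TopologicalSpace X] [MeasurableSpace X] {μ : Measure X}
    {F : X → Mat} (h : ∀ i j, LocallyIntegrable (fun z => F z i j) μ) :
    LocallyIntegrable (fun z => toV (F z)) μ := by
  have : (fun z => toV (F z)) = fun z => ∑ q : Fin 3 × Fin 3,
      F z q.1 q.2 • (EuclideanSpace.single q 1 : VMat) := by
    ext z q
    simp [toV_apply, Finset.sum_apply, Pi.single_apply]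
  rw [this]
  refine locallyIntegrable_finsetSum _ fun q _ x => ?_
  obtain ⟨s, hs, hi⟩ := h q.1 q.2 x
  exact ⟨s, hs, Integrable.smul_const hi _⟩

theorem hasWeakDeriv_toV {X : Type*} [NormedAddCommGroup X] [NormedSpace ℝ X] [MeasureSpace X]
    [OpensMeasurableSpace X] {v : X} {F G : X → Mat} (hF : LocallyIntegrable (fun z => toV (F z)))
    (hG : LocallyIntegrable (fun z => toV (G z)))
    (h : ∀ i j, HasWeakDeriv v (fun z => F z i j) (fun z => G z i j)) :
    HasWeakDeriv v (fun z => toV (F z)) (fun z => toV (G z)) := by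
  intro η hη hηc
  have c1 : Continuous (fun z => fderiv ℝ η z v) :=
    (hη.continuous_fderiv (by simp)).clm_apply continuous_const
  have i1 := hF.integrable_smul_left_of_hasCompactSupport c1 (hηc.fderiv_apply ℝ v)
  have i2 := hG.integrable_smul_left_of_hasCompactSupport hη.continuous hηc
  ext q
  rw [PiLp.neg_apply, eval_integral_piLp fun r => ?_, eval_integral_piLp fun r => ?_]
  · exact h q.1 q.2 η hη hηc
  · exact i2.eval_piLp r
  · exact i1.eval_piLp r

instance : (volume : Measure SpaceTime).IsAddHaarMeasure :=
  Measure.prod.instIsAddHaarMeasure volume volume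

theorem enorm_sq_eq_ofReal {E : Type*} [NormedAddCommGroup E] (a : E) :
    ‖a‖ₑ ^ 2 = ENNReal.ofReal (‖a‖ ^ 2) := by
  rw [← ofReal_norm, ENNReal.ofReal_pow (norm_nonneg _)]

/-! ### Local `L³` integrability from `L^∞_t H¹_x` -/

/-- A Gagliardo-Nirenberg inequality in `ℝ³`. -/
theorem exists_lintegral_cube_le : ∃ C : ℝ≥0, ∀ w : Space → ℝ, ContDiff ℝ 1 w →
    HasCompactSupport w →
    ∫⁻ x, ‖w x‖ₑ ^ 3 ≤
      C * ((∫⁻ x, ‖w x‖ₑ ^ 2) + ∫⁻ x, ‖fderiv ℝ w x‖ₑ ^ 2) ^ (3 / 2 : ℝ) := by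
  refine ⟨lintegralPowLePowLIntegralFDerivConst (volume : Measure Space) (3 / 2), fun w hw hwc => ?_⟩
  have hp : Real.HolderConjugate (Module.finrank ℝ Space) (3 / 2) := by
    rw [finrank_euclideanSpace_fin, Real.holderConjugate_iff]
    norm_num
  -- The `W^{1,1} → L^{3/2}` Sobolev inequality is applied to `w²`: `|w²|^{3/2} = |w|³` and `|∇(w²)|
  -- = 2|w||∇w| ≤ w² + |∇w|²`.
  have hwc2 : HasCompactSupport (fun x => w x ^ 2) :=
    hwc.comp_left (g := fun y : ℝ => y ^ 2) (by simp)
  have h := lintegral_pow_le_pow_lintegral_fderiv (volume : Measure Space)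
    (u := fun x => w x ^ 2) (hw.pow 2) hwc2 hp
  have e1 : ∀ x, ‖w x ^ 2‖ₑ ^ (3 / 2 : ℝ) = ‖w x‖ₑ ^ 3 := fun x => by
    rw [enorm_pow, ← ENNReal.rpow_natCast, ← ENNReal.rpow_mul, ← ENNReal.rpow_natCast]
    norm_num
  simp only [e1] at h
  refine h.trans ?_
  have hwm : Measurable (fun x => ‖w x‖ₑ ^ 2) := by
    have := hw.continuous.measurable
    fun_prop
  rw [← lintegral_add_left hwm]
  gcongr with x
  have hd : fderiv ℝ (fun x => w x ^ 2) x = (2 * w x) • fderiv ℝ w x := by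
    have := ((hw.differentiable (by simp) x).hasFDerivAt.pow 2).fderiv
    simpa using this
  rw [hd, enorm_sq_eq_ofReal, enorm_sq_eq_ofReal, ← ENNReal.ofReal_add (by positivity)
    (by positivity), ← ofReal_norm]
  refine ENNReal.ofReal_le_ofReal ?_
  rw [norm_smul, norm_mul]
  norm_num
  nlinarith [sq_nonneg (|w x| - ‖fderiv ℝ w x‖), sq_abs (w x)]

/-- Mollification does not increase the `L^∞_t L²_x` norm. -/
theorem lintegral_moll_slice_le {f : SpaceTime → ℝ} (hf : MemLp f 2) {K : ℝ≥0∞}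
    (hK : ∀ᵐ t : ℝ, ∫⁻ x : Space, ‖f (x, t)‖ₑ ^ 2 ≤ K) (n : ℕ) (t : ℝ) :
    ∫⁻ x : Space, ‖moll n f (x, t)‖ₑ ^ 2 ≤ K := by
  obtain ⟨g, hgm, hfg⟩ := hf.1
  have hgm : Measurable g := hgm.measurable
  have hg : MemLp g 2 := (memLp_congr_ae hfg).1 hf
  have hKg : ∀ᵐ t : ℝ, ∫⁻ x : Space, ‖g (x, t)‖ₑ ^ 2 ≤ K := by
    have h1 : ∀ᵐ t : ℝ, ∀ᵐ x : Space, f (x, t) = g (x, t) := by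
      have h2 : ∀ᵐ z : ℝ × Space, f z.swap = g z.swap :=
        (Measure.measurePreserving_swap (μ := (volume : Measure ℝ))
          (ν := (volume : Measure Space))).quasiMeasurePreserving.ae hfg
      exact Measure.ae_ae_of_ae_prod h2
    filter_upwards [hK, h1] with t ht h1t
    refine (le_of_eq (lintegral_congr_ae ?_)).trans ht
    filter_upwards [h1t] with x hx
    rw [hx]
  rw [moll_congr_ae hfg]
  have hgl : LocallyIntegrable g := hg.locallyIntegrable (by norm_num)
  have hg2 : LocallyIntegrable (fun w => ‖g w‖ ^ 2) :=
    (hg.integrable_norm_pow two_ne_zero).locallyIntegrable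
  have hρ : Continuous (mollKer SpaceTime n) := (contDiff_mollKer n (m := 0)).continuous
  -- Jensen moves the square inside the kernel average. Tonelli and translation invariance in `x`
  -- then leave slices at times `t - w.2`, which obey the bound for almost every `w`. This is why
  -- the conclusion holds for every `t`.
  have h1 : ∀ z, ‖moll n g z‖ₑ ^ 2
      ≤ ∫⁻ w, ENNReal.ofReal (mollKer SpaceTime n w) * ‖g (z - w)‖ₑ ^ 2 := fun z => by
    rw [enorm_sq_eq_ofReal]
    refine (ENNReal.ofReal_le_ofReal (norm_moll_sq_le hgl hg2 z)).trans ?_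
    rw [moll_apply, ofReal_integral_eq_lintegral_ofReal (integrable_mollKer_smul hg2 z)
      (Eventually.of_forall fun w => mul_nonneg (mollKer_nonneg _ _) (by positivity))]
    refine lintegral_mono fun w => le_of_eq ?_
    rw [smul_eq_mul, ENNReal.ofReal_mul (mollKer_nonneg _ _), enorm_sq_eq_ofReal]
  calc ∫⁻ x : Space, ‖moll n g (x, t)‖ₑ ^ 2
      ≤ ∫⁻ x : Space, ∫⁻ w, ENNReal.ofReal (mollKer SpaceTime n w) * ‖g ((x, t) - w)‖ₑ ^ 2 :=
        lintegral_mono fun x => h1 (x, t)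
    _ = ∫⁻ w, ∫⁻ x : Space, ENNReal.ofReal (mollKer SpaceTime n w) * ‖g ((x, t) - w)‖ₑ ^ 2 := by
        refine lintegral_lintegral_swap (Measurable.aemeasurable ?_)
        have := hρ.measurable
        fun_prop
    _ ≤ ∫⁻ w, ENNReal.ofReal (mollKer SpaceTime n w) * K := by
        have h2 : ∀ᵐ w : SpaceTime, ∫⁻ x : Space, ‖g (x, t - w.2)‖ₑ ^ 2 ≤ K := by
          have h3 : ∀ᵐ s : ℝ, ∫⁻ x : Space, ‖g (x, t - s)‖ₑ ^ 2 ≤ K :=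
            (Measure.measurePreserving_sub_left volume t).quasiMeasurePreserving.ae hKg
          exact Measure.quasiMeasurePreserving_snd.ae h3
        refine lintegral_mono_ae ?_
        filter_upwards [h2] with w hw
        rw [lintegral_const_mul _ (by fun_prop)]
        gcongr
        refine le_trans (le_of_eq ?_) hw
        exact lintegral_sub_right_eq_self (fun x : Space => ‖g (x, t - w.2)‖ₑ ^ 2) w.1
    _ = K := by
        rw [lintegral_mul_const _ (by fun_prop), ← ofReal_integral_eq_lintegral_ofReal
          (hρ.integrable_of_hasCompactSupport (hasCompactSupport_mollKer n))
          (Eventually.of_forall fun w => mollKer_nonneg _ _), integral_mollKer]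
        simp

theorem norm_le_sum_single (L : Space →L[ℝ] ℝ) : ‖L‖ ≤ ∑ k, |L (EuclideanSpace.single k 1)| := by
  refine L.opNorm_le_bound (Finset.sum_nonneg fun _ _ => abs_nonneg _) fun x => ?_
  have hx : x = ∑ k, x k • EuclideanSpace.single k (1 : ℝ) := by
    ext j; simp [Pi.single_apply]
  conv_lhs => rw [hx]
  rw [map_sum, Finset.sum_mul]
  refine (norm_sum_le _ _).trans (Finset.sum_le_sum fun k _ => ?_)
  rw [map_smul, smul_eq_mul, norm_mul, mul_comm]
  exact mul_le_mul_of_nonneg_left (PiLp.norm_apply_le x k) (abs_nonneg _)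

/-- The Sobolev embedding: functions in `L^∞_t H¹_x` are locally in `L³`. -/
theorem locallyIntegrable_cube {q : SpaceTime → ℝ} {p : Fin 3 → SpaceTime → ℝ} (hq : MemLp q 2)
    (hp : ∀ k, MemLp (p k) 2) (h : ∀ k, HasWeakDeriv (eX k) q (p k)) {K : ℝ≥0}
    (hqK : ∀ᵐ t : ℝ, ∫⁻ x : Space, ‖q (x, t)‖ₑ ^ 2 ≤ K)
    (hpK : ∀ k, ∀ᵐ t : ℝ, ∫⁻ x : Space, ‖p k (x, t)‖ₑ ^ 2 ≤ K) :
    LocallyIntegrable (fun z => |q z| ^ 3) := by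
  obtain ⟨C, hC⟩ := exists_lintegral_cube_le
  have hql : LocallyIntegrable q := hq.locallyIntegrable (by norm_num)
  rw [locallyIntegrable_iff]
  intro k hk
  obtain ⟨R, hR0, hR⟩ : ∃ R : ℝ, 0 < R ∧ k ⊆ Metric.closedBall 0 R := by
    obtain ⟨R, hR⟩ := hk.isBounded.subset_closedBall 0
    exact ⟨max R 1, by positivity, hR.trans (Metric.closedBall_subset_closedBall (le_max_left _ _))⟩
  -- The Gagliardo-Nirenberg inequality needs compact support in `x`; this cutoff equals 1 on the
  -- ball containing the spatial projection of `k`.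
  set χ : ContDiffBump (0 : Space) := ⟨R, R + 1, hR0, by linarith⟩ with hχ
  have hχs : ContDiff ℝ 1 (χ : Space → ℝ) := χ.contDiff
  obtain ⟨B, hB⟩ := (hχs.continuous_fderiv (by simp)).bounded_above_of_compact_support
    (χ.hasCompactSupport.fderiv ℝ)
  have hB0 : 0 ≤ B := (norm_nonneg _).trans (hB 0)
  -- The gradient of `χ q` is bounded by a sum of four terms, three partial derivatives and `B |q|`.
  -- Squaring costs a factor 4, whence `12 = 4 · 3` and `4 B²`.
  set D : ℝ≥0∞ := C * (K + (12 * K + ENNReal.ofReal (4 * B ^ 2) * K)) ^ (3 / 2 : ℝ) with hD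
  have hDt : D ≠ ⊤ := by
    refine ENNReal.mul_ne_top ENNReal.coe_ne_top (ENNReal.rpow_ne_top_of_nonneg (by norm_num) ?_)
    simp [ENNReal.mul_eq_top]
  have hslice : ∀ n (t : ℝ), ∫⁻ x : Space, ‖χ x * moll n q (x, t)‖ₑ ^ 3 ≤ D := fun n t => by
    have hm : ContDiff ℝ 1 (fun x : Space => moll n q (x, t)) :=
      (contDiff_moll hql (m := 1)).comp (contDiff_id.prodMk contDiff_const)
    refine (hC (fun x => χ x * moll n q (x, t)) (hχs.mul hm) χ.hasCompactSupport.mul_right).trans ?_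
    have s0 := lintegral_moll_slice_le hq hqK n t
    have sp := fun k => lintegral_moll_slice_le (hp k) (hpK k) n t
    rw [hD]
    gcongr C * ?_ ^ (3 / 2 : ℝ)
    refine add_le_add ?_ ?_
    · refine (lintegral_mono fun x => ?_).trans s0
      rw [enorm_sq_eq_ofReal, enorm_sq_eq_ofReal]
      refine ENNReal.ofReal_le_ofReal ?_
      rw [norm_mul]
      have : ‖χ x‖ ≤ 1 := by
        rw [Real.norm_eq_abs, abs_of_nonneg χ.nonneg]; exact χ.le_one
      gcongr
      exact mul_le_of_le_one_left (norm_nonneg _) this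
    · have hpt : ∀ x : Space, ‖fderiv ℝ (fun x => χ x * moll n q (x, t)) x‖ₑ ^ 2
          ≤ (∑ k, 4 * ‖moll n (p k) (x, t)‖ₑ ^ 2)
            + ENNReal.ofReal (4 * B ^ 2) * ‖moll n q (x, t)‖ₑ ^ 2 := fun x => by
        have hχ1 : |χ x| ≤ 1 := by
          rw [abs_of_nonneg χ.nonneg]; exact χ.le_one
        have hpart : ∀ k, fderiv ℝ (fun x : Space => moll n q (x, t)) x
            (EuclideanSpace.single k 1) = moll n (p k) (x, t) := fun k => by
          rw [← (h k).fderiv_moll hql n (x, t)]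
          have h1 : HasFDerivAt (moll n q) (fderiv ℝ (moll n q) (x, t)) (x, t) :=
            ((contDiff_moll hql (m := 1)).differentiable (by simp) _).hasFDerivAt
          have h2 : HasFDerivAt (fun x : Space => moll n q (x, t))
              ((fderiv ℝ (moll n q) (x, t)).comp (ContinuousLinearMap.inl ℝ Space ℝ)) x :=
            HasFDerivAt.comp (g := moll n q) x h1 (hasFDerivAt_prodMk_left x t)
          rw [h2.fderiv]
          rfl
        have hn1 := norm_le_sum_single (fderiv ℝ (fun x : Space => moll n q (x, t)) x)
        simp only [hpart] at hn1
        rw [fderiv_fun_mul (hχs.differentiable (by simp) x) (hm.differentiable (by simp) x)]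
        simp only [enorm_sq_eq_ofReal]
        rw [show (4 : ℝ≥0∞) = ENNReal.ofReal 4 by simp]
        simp only [← ENNReal.ofReal_mul (show (0 : ℝ) ≤ 4 by norm_num)]
        rw [← ENNReal.ofReal_sum_of_nonneg (fun _ _ => by positivity),
          ← ENNReal.ofReal_mul (by positivity), ← ENNReal.ofReal_add
          (Finset.sum_nonneg fun _ _ => by positivity) (by positivity)]
        refine ENNReal.ofReal_le_ofReal ?_
        have hn2 : ‖χ x • fderiv ℝ (fun x : Space => moll n q (x, t)) x
            + moll n q (x, t) • fderiv ℝ χ x‖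
            ≤ (∑ k, |moll n (p k) (x, t)|) + |moll n q (x, t)| * B := by
          refine (norm_add_le _ _).trans ?_
          rw [norm_smul, norm_smul]
          refine add_le_add ((mul_le_of_le_one_left (norm_nonneg _) hχ1).trans hn1) ?_
          exact mul_le_mul_of_nonneg_left (hB x) (abs_nonneg _)
        refine (pow_le_pow_left₀ (norm_nonneg _) hn2 2).trans ?_
        simp only [Fin.sum_univ_three, Real.norm_eq_abs]
        generalize |moll n (p 0) (x, t)| = a0
        generalize |moll n (p 1) (x, t)| = a1
        generalize |moll n (p 2) (x, t)| = a2
        generalize |moll n q (x, t)| = a3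
        nlinarith [sq_nonneg (a0 - a1), sq_nonneg (a0 - a2), sq_nonneg (a1 - a2),
          sq_nonneg (a0 - a3 * B), sq_nonneg (a1 - a3 * B), sq_nonneg (a2 - a3 * B)]
      have hmeas : ∀ {f : SpaceTime → ℝ}, MemLp f 2 →
          Measurable fun x : Space => ‖moll n f (x, t)‖ₑ ^ 2 := fun {f} hf => by
        have : Measurable (moll n f) :=
          (contDiff_moll (hf.locallyIntegrable (by norm_num)) (m := 0)).continuous.measurable
        fun_prop
      refine (lintegral_mono hpt).trans ?_
      rw [lintegral_add_right _ ((hmeas hq).const_mul _), lintegral_const_mul _ (hmeas hq),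
        lintegral_finsetSum _ fun k _ => (hmeas (hp k)).const_mul _]
      gcongr
      calc ∑ k, ∫⁻ x : Space, 4 * ‖moll n (p k) (x, t)‖ₑ ^ 2
          ≤ ∑ k : Fin 3, 4 * (K : ℝ≥0∞) := by
            refine Finset.sum_le_sum fun k _ => ?_
            rw [lintegral_const_mul _ (hmeas (hp k))]
            gcongr
            exact sp k
        _ = 12 * K := by
            simp only [Finset.sum_const, Finset.card_univ, Fintype.card_fin, nsmul_eq_mul]
            rw [← mul_assoc]; norm_num
  set ν : Measure ℝ := volume.restrict (Set.Icc (-R) R) with hν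
  set μ : Measure SpaceTime := (volume : Measure Space).prod ν with hμ
  have hμv : μ = volume.restrict (Set.univ ×ˢ Set.Icc (-R) R) := by
    rw [hμ, hν, Measure.volume_eq_prod, ← Measure.prod_restrict, Measure.restrict_univ]
  have hint : ∀ n, ∫⁻ z, ‖χ z.1 * moll n q z‖ₑ ^ 3 ∂μ ≤ D * ν Set.univ := fun n => by
    have hmm : Measurable (moll n q) := (contDiff_moll hql (m := 0)).continuous.measurable
    have hχm : Measurable χ := hχs.continuous.measurable
    rw [hμ, lintegral_prod_symm _ (by fun_prop), ← lintegral_const]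
    exact lintegral_mono fun t => hslice n t
  -- Fatou's lemma passes the bound, uniform in `n`, from the mollifications to `q`.
  have hlim : ∫⁻ z, ‖χ z.1 * q z‖ₑ ^ 3 ∂μ ≤ D * ν Set.univ := by
    have hae : ∀ᵐ z ∂μ, Tendsto (fun n => ‖χ z.1 * moll n q z‖ₑ ^ 3) atTop
        (𝓝 (‖χ z.1 * q z‖ₑ ^ 3)) := by
      rw [hμv]
      filter_upwards [ae_restrict_of_ae (ae_tendsto_moll hql)] with z hz
      exact ((ENNReal.continuous_pow 3).tendsto _).comp ((hz.const_mul _).enorm)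
    calc ∫⁻ z, ‖χ z.1 * q z‖ₑ ^ 3 ∂μ
        = ∫⁻ z, liminf (fun n => ‖χ z.1 * moll n q z‖ₑ ^ 3) atTop ∂μ :=
          lintegral_congr_ae (hae.mono fun z hz => hz.liminf_eq.symm)
      _ ≤ liminf (fun n => ∫⁻ z, ‖χ z.1 * moll n q z‖ₑ ^ 3 ∂μ) atTop := by
          refine lintegral_liminf_le fun n => ?_
          have hmm : Measurable (moll n q) := (contDiff_moll hql (m := 0)).continuous.measurable
          have hχm : Measurable χ := hχs.continuous.measurable
          fun_prop
      _ ≤ D * ν Set.univ := by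
          refine liminf_le_of_le (by isBoundedDefault) fun b hb => ?_
          obtain ⟨n, hn⟩ := hb.exists
          exact hn.trans (hint n)
  refine ⟨(hq.1.norm.pow 3).restrict, ?_⟩
  rw [hasFiniteIntegral_iff_enorm]
  have hkm : MeasurableSet k := hk.measurableSet
  have hkc : ∀ z ∈ k, z ∈ (Set.univ : Set Space) ×ˢ Set.Icc (-R) R ∧ χ z.1 = 1 := fun z hz => by
    have hz := hR hz
    rw [mem_closedBall_zero_iff, Prod.norm_def, max_le_iff] at hz
    refine ⟨⟨Set.mem_univ _, abs_le.1 hz.2⟩, χ.one_of_mem_closedBall ?_⟩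
    rw [mem_closedBall_zero_iff]; exact hz.1
  calc ∫⁻ z in k, ‖|q z| ^ 3‖ₑ = ∫⁻ z in k, ‖χ z.1 * q z‖ₑ ^ 3 := by
        refine setLIntegral_congr_fun hkm fun z hz => ?_
        simp only [(hkc z hz).2, one_mul, enorm_pow, Real.enorm_abs]
    _ ≤ ∫⁻ z, ‖χ z.1 * q z‖ₑ ^ 3 ∂μ := by
        rw [hμv]
        exact lintegral_mono_set fun z hz => (hkc z hz).1
    _ ≤ D * ν Set.univ := hlim
    _ < ⊤ := by
        refine ENNReal.mul_lt_top hDt.lt_top ?_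
        simp [hν]

/-! ### A smooth convex substitute for the positive part -/

/-- A smooth convex function of linear growth, vanishing exactly on the negative half-line. -/
def softPos (x : ℝ) : ℝ := x * expNegInvGlue x

/-- The derivative of `softPos`. -/
def softPos' (x : ℝ) : ℝ := (1 + x⁻¹) * expNegInvGlue x

/-- The second derivative of `softPos`. -/
def softPos'' (x : ℝ) : ℝ := x⁻¹ ^ 3 * expNegInvGlue x

theorem contDiff_softPos : ContDiff ℝ (⊤ : ℕ∞) softPos := contDiff_id.mul expNegInvGlue.contDiff

theorem contDiff_softPos' : ContDiff ℝ (⊤ : ℕ∞) softPos' := by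
  have := expNegInvGlue.contDiff_polynomial_eval_inv_mul (n := ⊤) (1 + Polynomial.X)
  simp only [Polynomial.eval_add, Polynomial.eval_one, Polynomial.eval_X] at this
  exact this

theorem hasDerivAt_softPos (x : ℝ) : HasDerivAt softPos (softPos' x) x := by
  have h := expNegInvGlue.hasDerivAt_polynomial_eval_inv_mul 1 x
  simp only [Polynomial.eval_one, one_mul, Polynomial.derivative_one, sub_zero, mul_one,
    Polynomial.eval_pow, Polynomial.eval_X] at h
  have h2 := (hasDerivAt_id x).mul h
  convert! h2 using 1
  simp only [softPos', id]
  rcases eq_or_ne x 0 with rfl | hx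
  · simp
  · field_simp

theorem hasDerivAt_softPos' (x : ℝ) : HasDerivAt softPos' (softPos'' x) x := by
  have h := expNegInvGlue.hasDerivAt_polynomial_eval_inv_mul (1 + Polynomial.X) x
  convert! h using 1
  · ext y; simp [softPos']
  · simp only [softPos'', Polynomial.eval_mul, Polynomial.eval_pow, Polynomial.eval_X,
      Polynomial.eval_sub, Polynomial.eval_add, Polynomial.eval_one, Polynomial.derivative_add,
      Polynomial.derivative_one, Polynomial.derivative_X, Polynomial.eval_zero]
    ring

theorem softPos_nonneg (x : ℝ) : 0 ≤ softPos x := by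
  rcases le_or_gt x 0 with h | h
  · simp [softPos, expNegInvGlue.zero_of_nonpos h]
  · exact mul_nonneg h.le (expNegInvGlue.nonneg x)

theorem softPos_pos {x : ℝ} (h : 0 < x) : 0 < softPos x := mul_pos h (expNegInvGlue.pos_of_pos h)

theorem softPos_of_nonpos {x : ℝ} (h : x ≤ 0) : softPos x = 0 := by
  simp [softPos, expNegInvGlue.zero_of_nonpos h]

theorem softPos'_of_nonpos {x : ℝ} (h : x ≤ 0) : softPos' x = 0 := by
  simp [softPos', expNegInvGlue.zero_of_nonpos h]

theorem expNegInvGlue_of_pos {x : ℝ} (h : 0 < x) : expNegInvGlue x = Real.exp (-x⁻¹) := by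
  simp [expNegInvGlue, h.not_ge]

theorem expNegInvGlue_le_one (x : ℝ) : expNegInvGlue x ≤ 1 := by
  rcases le_or_gt x 0 with h | h
  · simp [expNegInvGlue.zero_of_nonpos h]
  · rw [expNegInvGlue_of_pos h]
    exact Real.exp_le_one_iff.2 (by simp [h.le])

theorem softPos'_nonneg (x : ℝ) : 0 ≤ softPos' x := by
  rcases le_or_gt x 0 with h | h
  · rw [softPos'_of_nonpos h]
  · exact mul_nonneg (by positivity) (expNegInvGlue.nonneg x)

theorem softPos''_nonneg (x : ℝ) : 0 ≤ softPos'' x := by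
  rcases le_or_gt x 0 with h | h
  · simp [softPos'', expNegInvGlue.zero_of_nonpos h]
  · exact mul_nonneg (by positivity) (expNegInvGlue.nonneg x)

/-- With `y = x⁻¹` for positive `x`, this is `1 + y ≤ exp y`. -/
theorem softPos'_le_one (x : ℝ) : softPos' x ≤ 1 := by
  rcases le_or_gt x 0 with h | h
  · rw [softPos'_of_nonpos h]; norm_num
  · rw [softPos', expNegInvGlue_of_pos h, Real.exp_neg, ← div_eq_mul_inv,
      div_le_one (Real.exp_pos _)]
    linarith [Real.add_one_le_exp x⁻¹]

/-- With `y = x⁻¹` for positive `x`, this is `y³ ≤ 3! · exp y`. -/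
theorem softPos''_le (x : ℝ) : softPos'' x ≤ 6 := by
  rcases le_or_gt x 0 with h | h
  · simp [softPos'', expNegInvGlue.zero_of_nonpos h]
  · rw [softPos'', expNegInvGlue_of_pos h, Real.exp_neg, ← div_eq_mul_inv,
      div_le_iff₀ (Real.exp_pos _)]
    have := Real.pow_div_factorial_le_exp (x := x⁻¹) (by positivity) 3
    rw [div_le_iff₀ (by positivity)] at this
    simpa [Nat.factorial, mul_comm] using this

theorem softPos_le {x : ℝ} (h : 0 ≤ x) : softPos x ≤ x :=
  mul_le_of_le_one_right h (expNegInvGlue_le_one x)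

/-! ### The radial entropy: gradient, Hessian and convexity -/

section Entropy

variable {V : Type*} [NormedAddCommGroup V] [InnerProductSpace ℝ V]

/-- The regularized norm `√(1 + |A|²)`. -/
def jnorm (A : V) : ℝ := √(1 + ‖A‖ ^ 2)

theorem jnorm_sq (A : V) : jnorm A ^ 2 = 1 + ‖A‖ ^ 2 := Real.sq_sqrt (by positivity)

theorem one_le_jnorm (A : V) : 1 ≤ jnorm A := Real.one_le_sqrt.2 (by nlinarith [norm_nonneg A])

theorem jnorm_pos (A : V) : 0 < jnorm A := one_pos.trans_le (one_le_jnorm A)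

theorem norm_le_jnorm (A : V) : ‖A‖ ≤ jnorm A := Real.le_sqrt_of_sq_le (by linarith)

theorem contDiff_jnorm : ContDiff ℝ (⊤ : ℕ∞) (jnorm : V → ℝ) := by
  refine ContDiff.sqrt (contDiff_const.add (contDiff_norm_sq ℝ)) fun A => ?_
  positivity

theorem hasFDerivAt_jnorm (A : V) : HasFDerivAt jnorm ((jnorm A)⁻¹ • innerSL ℝ A) A := by
  have h1 : HasFDerivAt (fun A : V => 1 + ‖A‖ ^ 2) (2 • innerSL ℝ A) A :=
    (hasStrictFDerivAt_norm_sq A).hasFDerivAt.const_add 1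
  have h2 := h1.sqrt (by positivity)
  convert! h2 using 1
  ext B
  simp [jnorm]
  ring

/-- A smooth convex function vanishing exactly where `jnorm A ≤ r`. -/
def entropy (r : ℝ) (A : V) : ℝ := softPos (jnorm A - r)

/-- The weight in the gradient of `entropy`. -/
def weight (r : ℝ) (A : V) : ℝ := softPos' (jnorm A - r) / jnorm A

/-- The component in the direction `e` of the gradient of `entropy`. -/
def entropyGrad (r : ℝ) (e A : V) : ℝ := weight r A * inner ℝ e A

theorem contDiff_entropy (r : ℝ) : ContDiff ℝ (⊤ : ℕ∞) (entropy r : V → ℝ) :=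
  contDiff_softPos.comp (contDiff_jnorm.sub contDiff_const)

theorem contDiff_weight (r : ℝ) : ContDiff ℝ (⊤ : ℕ∞) (weight r : V → ℝ) :=
  (contDiff_softPos'.comp (contDiff_jnorm.sub contDiff_const)).div contDiff_jnorm
    fun A => (jnorm_pos A).ne'

theorem contDiff_entropyGrad (r : ℝ) (e : V) : ContDiff ℝ (⊤ : ℕ∞) (entropyGrad r e) :=
  (contDiff_weight r).mul (contDiff_const.inner ℝ contDiff_id)

theorem weight_nonneg (r : ℝ) (A : V) : 0 ≤ weight r A :=
  div_nonneg (softPos'_nonneg _) (jnorm_pos A).le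

theorem weight_mul_norm_le (r : ℝ) (A : V) : weight r A * ‖A‖ ≤ 1 := by
  rw [weight, div_mul_eq_mul_div, div_le_one (jnorm_pos A)]
  exact (mul_le_of_le_one_left (norm_nonneg _) (softPos'_le_one _)).trans (norm_le_jnorm A)

theorem weight_le_one (r : ℝ) (A : V) : weight r A ≤ 1 := by
  rw [weight, div_le_one (jnorm_pos A)]
  exact (softPos'_le_one _).trans (one_le_jnorm A)

theorem fderiv_entropy (r : ℝ) (A B : V) :
    fderiv ℝ (entropy r) A B = weight r A * inner ℝ A B := by
  have h := (hasDerivAt_softPos (jnorm A - r)).comp_hasFDerivAt A ((hasFDerivAt_jnorm A).sub_const r)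
  have h' : HasFDerivAt (entropy r : V → ℝ)
    (softPos' (jnorm A - r) • (jnorm A)⁻¹ • innerSL ℝ A) A := h
  rw [h'.fderiv]
  simp [weight]
  ring

/-- The entropy is Lipschitz however large `A` is. This is what allows it to be composed with an
unbounded `Q` and paired with a time derivative that is merely locally integrable. -/
theorem norm_fderiv_entropy_le (r : ℝ) (A : V) : ‖fderiv ℝ (entropy r) A‖ ≤ 1 := by
  refine ContinuousLinearMap.opNorm_le_bound _ zero_le_one fun B => ?_
  rw [fderiv_entropy, norm_mul, Real.norm_eq_abs, abs_of_nonneg (weight_nonneg r A)]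
  calc weight r A * ‖inner ℝ A B‖ ≤ weight r A * (‖A‖ * ‖B‖) :=
        mul_le_mul_of_nonneg_left (norm_inner_le_norm A B) (weight_nonneg r A)
    _ = weight r A * ‖A‖ * ‖B‖ := by ring
    _ ≤ 1 * ‖B‖ := mul_le_mul_of_nonneg_right (weight_mul_norm_le r A) (norm_nonneg _)

/-- The radial factor in the derivative of `weight`. -/
def weight' (r : ℝ) (A : V) : ℝ :=
  softPos'' (jnorm A - r) / jnorm A ^ 2 - softPos' (jnorm A - r) / jnorm A ^ 3

theorem fderiv_entropyGrad (r : ℝ) (e A B : V) :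
    fderiv ℝ (entropyGrad r e) A B
      = weight' r A * inner ℝ A B * inner ℝ e A + weight r A * inner ℝ e B := by
  have hj := jnorm_pos A
  have h1 : HasFDerivAt (fun A : V => softPos' (jnorm A - r))
      (softPos'' (jnorm A - r) • (jnorm A)⁻¹ • innerSL ℝ A) A :=
    HasDerivAt.comp_hasFDerivAt (h₂ := softPos') A (hasDerivAt_softPos' (jnorm A - r))
      ((hasFDerivAt_jnorm A).sub_const r)
  have h2 : HasFDerivAt (fun A : V => (jnorm A)⁻¹)
      ((-(jnorm A ^ 2)⁻¹) • (jnorm A)⁻¹ • innerSL ℝ A) A :=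
    (hasDerivAt_inv hj.ne').comp_hasFDerivAt A (hasFDerivAt_jnorm A)
  have h3 := (h1.mul h2).mul (innerSL ℝ e).hasFDerivAt
  have h4 : HasFDerivAt (entropyGrad r e) _ A := h3
  rw [h4.fderiv]
  simp [weight', weight]
  field_simp
  ring

/-- Convexity: the expression is the Hessian of the entropy evaluated on `B`. Its only negative part
comes from differentiating `1 / jnorm`, and Cauchy-Schwarz with `‖A‖ ≤ jnorm A` absorbs it into the
`weight` term. -/
theorem weight'_mul_sq_ge (r : ℝ) (A B : V) :
    0 ≤ weight' r A * inner ℝ A B ^ 2 + weight r A * ‖B‖ ^ 2 := by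
  have hj := jnorm_pos A
  have h1 : inner ℝ A B ^ 2 ≤ jnorm A ^ 2 * ‖B‖ ^ 2 := by
    rw [← mul_pow, ← sq_abs]
    refine pow_le_pow_left₀ (abs_nonneg _) ((abs_real_inner_le_norm A B).trans ?_) 2
    exact mul_le_mul_of_nonneg_right (norm_le_jnorm A) (norm_nonneg _)
  have h2 : 0 ≤ softPos'' (jnorm A - r) / jnorm A ^ 2 * inner ℝ A B ^ 2 :=
    mul_nonneg (div_nonneg (softPos''_nonneg _) (by positivity)) (sq_nonneg _)
  have h3 : softPos' (jnorm A - r) / jnorm A ^ 3 * inner ℝ A B ^ 2 ≤ weight r A * ‖B‖ ^ 2 := by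
    calc softPos' (jnorm A - r) / jnorm A ^ 3 * inner ℝ A B ^ 2
        ≤ softPos' (jnorm A - r) / jnorm A ^ 3 * (jnorm A ^ 2 * ‖B‖ ^ 2) :=
          mul_le_mul_of_nonneg_left h1 (div_nonneg (softPos'_nonneg _) (by positivity))
      _ = weight r A * ‖B‖ ^ 2 := by rw [weight]; field_simp
  rw [weight', sub_mul]
  linarith

/-- The constant is `6 + 1`, from the bounds on `softPos''` and `softPos'`; the quadratic decay in
`jnorm A` compensates `‖A‖²`. -/
theorem abs_weight'_mul_sq_le (r : ℝ) (A : V) : |weight' r A| * ‖A‖ ^ 2 ≤ 7 := by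
  have hj := jnorm_pos A
  have h1 : |weight' r A| ≤ 7 / jnorm A ^ 2 := by
    refine (abs_sub _ _).trans ?_
    rw [abs_of_nonneg (div_nonneg (softPos''_nonneg _) (by positivity)),
      abs_of_nonneg (div_nonneg (softPos'_nonneg _) (by positivity))]
    have e : (7 : ℝ) / jnorm A ^ 2 = 6 / jnorm A ^ 2 + 1 / jnorm A ^ 2 := by ring
    rw [e]
    refine add_le_add (by gcongr; exact softPos''_le _) ?_
    refine div_le_div₀ zero_le_one (softPos'_le_one _) (by positivity) ?_
    exact pow_le_pow_right₀ (one_le_jnorm A) (by norm_num)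
  calc |weight' r A| * ‖A‖ ^ 2 ≤ 7 / jnorm A ^ 2 * jnorm A ^ 2 := by
        gcongr; exact norm_le_jnorm A
    _ = 7 := by field_simp

theorem norm_fderiv_entropyGrad_le (r : ℝ) (e A : V) :
    ‖fderiv ℝ (entropyGrad r e) A‖ ≤ 8 * ‖e‖ := by
  refine ContinuousLinearMap.opNorm_le_bound _ (by positivity) fun B => ?_
  rw [fderiv_entropyGrad]
  refine (norm_add_le _ _).trans ?_
  rw [norm_mul, norm_mul, norm_mul, Real.norm_eq_abs, Real.norm_eq_abs (weight r A),
    abs_of_nonneg (weight_nonneg r A)]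
  have h1 : |weight' r A| * ‖inner ℝ A B‖ * ‖inner ℝ e A‖ ≤ 7 * (‖e‖ * ‖B‖) := by
    calc |weight' r A| * ‖inner ℝ A B‖ * ‖inner ℝ e A‖
        ≤ |weight' r A| * (‖A‖ * ‖B‖) * (‖e‖ * ‖A‖) := by
          gcongr <;> exact norm_inner_le_norm _ _
      _ = |weight' r A| * ‖A‖ ^ 2 * (‖e‖ * ‖B‖) := by ring
      _ ≤ 7 * (‖e‖ * ‖B‖) := by gcongr; exact abs_weight'_mul_sq_le r A
  have h2 : weight r A * ‖inner ℝ e B‖ ≤ 1 * (‖e‖ * ‖B‖) := by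
    gcongr
    · exact weight_le_one r A
    · exact norm_inner_le_norm _ _
  linarith

theorem entropyGrad_zero (r : ℝ) (e : V) : entropyGrad r e 0 = 0 := by simp [entropyGrad]

theorem entropy_nonneg (r : ℝ) (A : V) : 0 ≤ entropy r A := softPos_nonneg _

theorem jnorm_le_iff {K : ℝ} (hK : 0 ≤ K) (A : V) : jnorm A ≤ √(1 + K ^ 2) ↔ ‖A‖ ≤ K := by
  rw [jnorm, Real.sqrt_le_sqrt_iff (by positivity), add_le_add_iff_left,
    sq_le_sq₀ (norm_nonneg _) hK]

/-- The level `√(1 + K²)` is the value of `jnorm` on the sphere of radius `K`, so zero entropy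
encodes the desired bound. -/
theorem entropy_eq_zero_iff {K : ℝ} (hK : 0 ≤ K) (A : V) :
    entropy √(1 + K ^ 2) A = 0 ↔ ‖A‖ ≤ K := by
  rw [← jnorm_le_iff hK]
  refine ⟨fun h => ?_, fun h => softPos_of_nonpos (by linarith)⟩
  by_contra hlt
  exact (softPos_pos (show 0 < jnorm A - √(1 + K ^ 2) by linarith)).ne' h

theorem weight_eq_zero {K : ℝ} (hK : 0 ≤ K) {A : V} (h : ‖A‖ ≤ K) :
    weight √(1 + K ^ 2) A = 0 := by
  rw [← jnorm_le_iff hK] at h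
  rw [weight, softPos'_of_nonpos (by linarith), zero_div]

/-- Where the entropy is positive, `jnorm A - r ≤ jnorm A - 1 ≤ jnorm A ^ 2 - 1 = ‖A‖ ^ 2`. The
quadratic bound makes the entropy of an `L²` field integrable over the whole of space. -/
theorem entropy_le {r : ℝ} (hr : 1 ≤ r) (A : V) : entropy r A ≤ ‖A‖ ^ 2 := by
  rcases le_or_gt (jnorm A - r) 0 with h | h
  · rw [entropy, softPos_of_nonpos h]; positivity
  · refine (softPos_le h.le).trans ?_
    nlinarith [jnorm_sq A, one_le_jnorm A]

end Entropy

/-! ### Integration by parts and integrability for weak solutions -/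

instance : IsLocallyFiniteMeasure domVol := by unfold domVol; infer_instance

theorem integral_eq_integral_domVol {F H : SpaceTime → ℝ} (h : ∀ z ∈ dom, F z = H z)
    (h0 : ∀ z ∉ dom, F z = 0) : ∫ z, F z = ∫ z, H z ∂domVol := by
  rw [domVol, ← setIntegral_eq_integral_of_forall_compl_eq_zero h0]
  exact setIntegral_congr_fun measurableSet_dom h

theorem indicator_dom_apply (F : SpaceTime → Mat) (i j : Fin 3) :
    (fun z => dom.indicator F z i j) = dom.indicator (fun z => F z i j) := by
  ext z; by_cases hz : z ∈ dom <;> simp [hz]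

theorem memLp_indicator_dom {f : SpaceTime → ℝ} (hf : MemLp f 2 domVol) :
    MemLp (dom.indicator f) 2 := (memLp_indicator_iff_restrict measurableSet_dom).2 hf

theorem memLp_toV_indicator {F : SpaceTime → Mat} (hF : ∀ i j, MemLp (fun z => F z i j) 2 domVol) :
    MemLp (fun z => toV (dom.indicator F z)) 2 :=
  memLp_toV fun i j => by rw [indicator_dom_apply]; exact memLp_indicator_dom (hF i j)

theorem hasWeakDeriv_toV_indicator {F G : SpaceTime → Mat} {k : Fin 3}
    (hF : ∀ i j, MemLp (fun z => F z i j) 2 domVol) (hG : ∀ i j, MemLp (fun z => G z i j) 2 domVol)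
    (h : ∀ i j, HasWeakDx k (fun z => F z i j) (fun z => G z i j)) :
    HasWeakDeriv (eX k) (fun z => toV (dom.indicator F z)) (fun z => toV (dom.indicator G z)) := by
  refine hasWeakDeriv_toV ((memLp_toV_indicator hF).locallyIntegrable (by norm_num))
    ((memLp_toV_indicator hG).locallyIntegrable (by norm_num)) fun i j => ?_
  rw [indicator_dom_apply, indicator_dom_apply]
  exact (h i j).hasWeakDeriv (hF i j) (hG i j)

/-- Local integrability for `domVol` is tested also at points with `t = 0`, so it excludes
concentration at the initial time and survives extension by zero. -/
theorem locallyIntegrable_indicator_dom {E : Type*} [NormedAddCommGroup E] {f : SpaceTime → E}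
    (hf : LocallyIntegrable f domVol) : LocallyIntegrable (dom.indicator f) := by
  intro x
  obtain ⟨s, hs, hi⟩ := hf x
  obtain ⟨t, hts, hto, hxt⟩ := mem_nhds_iff.1 hs
  refine ⟨t, hto.mem_nhds hxt, ?_⟩
  have h1 : IntegrableOn f t domVol := hi.mono_set hts
  rw [IntegrableOn, integrable_indicator_iff measurableSet_dom, IntegrableOn,
    Measure.restrict_comm measurableSet_dom]
  exact h1

/-- Slice bounds of the zero extension. -/
theorem BddL2.exists_lintegral_le {f : SpaceTime → ℝ} (h : BddL2 f) :
    ∃ K : ℝ≥0, ∀ᵐ t : ℝ, ∫⁻ x : Space, ‖dom.indicator f (x, t)‖ₑ ^ 2 ≤ K := by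
  obtain ⟨K, hK⟩ := h
  refine ⟨K ^ 2, ?_⟩
  rw [ae_restrict_iff' measurableSet_Ioi] at hK
  filter_upwards [hK] with t ht
  by_cases h0 : 0 < t
  · have h1 : ∀ x : Space, dom.indicator f (x, t) = f (x, t) := fun x =>
      Set.indicator_of_mem (show (x, t) ∈ dom from h0) f
    simp only [h1]
    have h2 := eLpNorm_nnreal_pow_eq_lintegral (μ := (volume : Measure Space))
      (f := fun x => f (x, t)) (p := 2) two_ne_zero
    simp only [NNReal.coe_ofNat, ENNReal.rpow_ofNat, ENNReal.coe_ofNat] at h2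
    rw [← h2, ENNReal.coe_pow]
    exact pow_le_pow_left₀ zero_le (ht h0) 2
  · have h1 : ∀ x : Space, dom.indicator f (x, t) = 0 := fun x =>
      Set.indicator_of_notMem (show (x, t) ∉ dom from h0) f
    simp [h1]

theorem ddot_smul_right (A S : Mat) (c : ℝ) : ddot A (c • S) = c * ddot A S := by
  simp only [ddot, Matrix.smul_apply, smul_eq_mul, Finset.mul_sum]
  refine Finset.sum_congr rfl fun i _ => Finset.sum_congr rfl fun j _ => by ring

theorem locallyIntegrable_ddot {F : SpaceTime → Mat} {μ : Measure SpaceTime}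
    (hF : ∀ i j, LocallyIntegrable (fun z => F z i j) μ) (S : Mat) :
    LocallyIntegrable (fun z => ddot (F z) S) μ := by
  unfold ddot
  refine locallyIntegrable_finsetSum _ fun i _ => locallyIntegrable_finsetSum _ fun j _ => ?_
  have := (hF i j).smul (S i j)
  refine this.congr (Eventually.of_forall fun z => ?_)
  simp [mul_comm]

section Solution

variable {a b c : ℝ} {u₀ : Space → Space} {Q₀ : Space → Mat} {u : SpaceTime → Space}
  {Q : SpaceTime → Mat} {Du : SpaceTime → Mat} {DQ : Fin 3 → SpaceTime → Mat}
  {D2Q : Fin 3 → Fin 3 → SpaceTime → Mat}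

/-- The test function may be nonzero at `t = 0`: differentiation is in a spatial direction, so
extending all fields by zero creates no boundary term. -/
theorem WeakSolutionWith.integral_mul_comp (W : WeakSolutionWith a b c u₀ Q₀ u Q Du DQ D2Q)
    {k : Fin 3} {w w' : SpaceTime → ℝ} (hww : HasWeakDx k w w') (hw : MemLp w 2 domVol)
    (hw' : MemLp w' 2 domVol) {G : VMat → ℝ} (hG : ContDiff ℝ (⊤ : ℕ∞) G) (hG0 : G 0 = 0) {C : ℝ}
    (hC : ∀ A, ‖fderiv ℝ G A‖ ≤ C) {η : SpaceTime → ℝ} (hη : ContDiff ℝ (⊤ : ℕ∞) η)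
    (hηc : HasCompactSupport η) :
    ∫ z, w' z * (G (toV (Q z)) * η z) ∂domVol
      = -∫ z, w z * (fderiv ℝ G (toV (Q z)) (toV (DQ k z)) * η z
          + G (toV (Q z)) * dx k η z) ∂domVol := by
  have h := (hww.hasWeakDeriv hw hw').integral_mul_comp (memLp_indicator_dom hw)
    (memLp_indicator_dom hw') (hasWeakDeriv_toV_indicator W.Q_L2 (W.DQ_L2 k) (W.DQ_weak k))
    (memLp_toV_indicator W.Q_L2) (memLp_toV_indicator (W.DQ_L2 k)) hG hG0 hC hη hηc
  rw [← integral_eq_integral_domVol (fun z hz => ?_) (fun z hz => ?_), h,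
    integral_eq_integral_domVol (fun z hz => ?_) (fun z hz => ?_)]
  · simp [hz, dx]
  · simp [hz]
  · simp [hz]
  · simp [hz]

theorem WeakSolutionWith.memLp_comp (W : WeakSolutionWith a b c u₀ Q₀ u Q Du DQ D2Q)
    {G : VMat → ℝ} (hG : ContDiff ℝ (⊤ : ℕ∞) G) (hG0 : G 0 = 0) {C : ℝ}
    (hC : ∀ A, ‖fderiv ℝ G A‖ ≤ C) : MemLp (fun z => G (toV (Q z))) 2 domVol := by
  have h1 : MemLp (fun z => toV (Q z)) 2 domVol := memLp_toV W.Q_L2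
  refine MemLp.of_le_mul (c := C) h1 (hG.continuous.comp_aestronglyMeasurable h1.1) ?_
  exact Eventually.of_forall fun z => abs_le_of_norm_fderiv_le hG hG0 hC _

/-- Functions of `Q` are transported without source by the divergence free field `u`. -/
theorem WeakSolutionWith.transport (W : WeakSolutionWith a b c u₀ Q₀ u Q Du DQ D2Q)
    {G : VMat → ℝ} (hG : ContDiff ℝ (⊤ : ℕ∞) G) (hG0 : G 0 = 0) {C : ℝ}
    (hC : ∀ A, ‖fderiv ℝ G A‖ ≤ C) {η : SpaceTime → ℝ} (hη : ContDiff ℝ (⊤ : ℕ∞) η)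
    (hηc : HasCompactSupport η) :
    ∑ k, ∫ z, u z k * (fderiv ℝ G (toV (Q z)) (toV (DQ k z)) * η z
          + G (toV (Q z)) * dx k η z) ∂domVol = 0 := by
  have h1 : ∀ k, ∫ z, u z k * (fderiv ℝ G (toV (Q z)) (toV (DQ k z)) * η z
          + G (toV (Q z)) * dx k η z) ∂domVol
        = -∫ z, Du z k k * (G (toV (Q z)) * η z) ∂domVol := fun k => by
    rw [W.integral_mul_comp (W.Du_weak k k) (W.u_L2 k) (W.Du_L2 k k) hG hG0 hC hη hηc, neg_neg]
  obtain ⟨B, hB⟩ := hη.continuous.bounded_above_of_compact_support hηc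
  have hi : ∀ k, Integrable (fun z => Du z k k * (G (toV (Q z)) * η z)) domVol := fun k => by
    have := (MemLp.integrable_mul (p := 2) (q := 2) (W.Du_L2 k k) (W.memLp_comp hG hG0 hC)).mul_bdd
      hη.continuous.aestronglyMeasurable (Eventually.of_forall hB)
    refine this.congr (Eventually.of_forall fun z => ?_)
    simp [mul_assoc]
  simp only [h1, Finset.sum_neg_distrib, neg_eq_zero]
  rw [← integral_finsetSum _ fun k _ => hi k]
  refine integral_eq_zero_of_ae ?_
  filter_upwards [W.div_free] with z hz
  rw [← Finset.sum_mul, hz]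
  simp

/-- This gives meaning to the cubic term `c tr(Q²) Q`, which the `L²` bounds alone do not control.
-/
theorem WeakSolutionWith.locallyIntegrable_cube (W : WeakSolutionWith a b c u₀ Q₀ u Q Du DQ D2Q)
    (i j : Fin 3) : LocallyIntegrable (fun z => |Q z i j| ^ 3) domVol := by
  obtain ⟨K, hK⟩ := (W.Q_bdd i j).exists_lintegral_le
  choose K' hK' using fun k => (W.DQ_bdd k i j).exists_lintegral_le
  have hle : K ≤ K + ∑ k, K' k := le_self_add
  have hle' : ∀ k, K' k ≤ K + ∑ k, K' k := fun k =>
    (Finset.single_le_sum (fun _ _ => zero_le) (Finset.mem_univ k)).trans le_add_self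
  have h := BerisEdwards.locallyIntegrable_cube (K := K + ∑ k, K' k)
    (memLp_indicator_dom (W.Q_L2 i j)) (fun k => memLp_indicator_dom (W.DQ_L2 k i j))
    (fun k => (W.DQ_weak k i j).hasWeakDeriv (W.Q_L2 i j) (W.DQ_L2 k i j))
    (hK.mono fun t ht => ht.trans (by exact_mod_cast hle))
    (fun k => (hK' k).mono fun t ht => ht.trans (by exact_mod_cast hle' k))
  intro x
  obtain ⟨s, hs, hi⟩ := h x
  refine ⟨s, hs, ?_⟩
  have h1 : IntegrableOn (fun z => |dom.indicator (fun z => Q z i j) z| ^ 3) s domVol :=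
    Integrable.mono_measure hi (Measure.restrict_mono_measure Measure.restrict_le_self _)
  refine Integrable.congr h1 (ae_restrict_of_ae ?_)
  filter_upwards [ae_restrict_mem measurableSet_dom] with z hz
  simp [hz]

/-- Domination by `x y w ≤ x³ + y³ + w³` for nonnegative numbers. -/
theorem WeakSolutionWith.locallyIntegrable_mul_mul
    (W : WeakSolutionWith a b c u₀ Q₀ u Q Du DQ D2Q) (i j k l m n : Fin 3) :
    LocallyIntegrable (fun z => Q z i j * Q z k l * Q z m n) domVol := by
  refine (((W.locallyIntegrable_cube i j).add (W.locallyIntegrable_cube k l)).add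
    (W.locallyIntegrable_cube m n)).mono
    (((W.Q_L2 i j).1.mul (W.Q_L2 k l).1).mul (W.Q_L2 m n).1) (Eventually.of_forall fun z => ?_)
  simp only [Pi.add_apply, Real.norm_eq_abs, abs_mul]
  generalize hx : |Q z i j| = x
  generalize hy : |Q z k l| = y
  generalize hw : |Q z m n| = w
  have hx0 : 0 ≤ x := hx ▸ abs_nonneg _
  have hy0 : 0 ≤ y := hy ▸ abs_nonneg _
  have hw0 : 0 ≤ w := hw ▸ abs_nonneg _
  rw [abs_of_nonneg (by positivity)]
  nlinarith [mul_nonneg hx0 (sq_nonneg (x - y)), mul_nonneg hx0 (sq_nonneg (y - w)),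
    mul_nonneg hx0 (sq_nonneg (x - w)), mul_nonneg hy0 (sq_nonneg (x - y)),
    mul_nonneg hy0 (sq_nonneg (y - w)), mul_nonneg hy0 (sq_nonneg (x - w)),
    mul_nonneg hw0 (sq_nonneg (x - y)), mul_nonneg hw0 (sq_nonneg (y - w)),
    mul_nonneg hw0 (sq_nonneg (x - w)), mul_nonneg (mul_nonneg hx0 hy0) hw0]

end Solution

/-! ### The `Q`-equation on all of space-time, including the initial condition -/

theorem locallyIntegrable_comp_fst {h : Space → ℝ} (hh : LocallyIntegrable h) :
    LocallyIntegrable (fun z : SpaceTime => h z.1) := by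
  rw [locallyIntegrable_iff]
  intro k hk
  obtain ⟨R, hR⟩ := hk.isBounded.subset_closedBall 0
  have h1 : Integrable (fun z : SpaceTime => (Metric.closedBall (0 : Space) R).indicator h z.1
      * (Set.Icc (-R) R).indicator (fun _ => (1 : ℝ)) z.2) :=
    Integrable.mul_prod ((integrable_indicator_iff measurableSet_closedBall).2
      (hh.integrableOn_isCompact (isCompact_closedBall 0 R)))
      ((integrable_indicator_iff measurableSet_Icc).2
        (integrableOn_const (by simp) (by simp)))
  refine h1.integrableOn.congr_fun (fun z hz => ?_) hk.measurableSet
  have hz := hR hz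
  rw [mem_closedBall_zero_iff, Prod.norm_def, max_le_iff] at hz
  have e1 : z.1 ∈ Metric.closedBall (0 : Space) R := by rw [mem_closedBall_zero_iff]; exact hz.1
  have e2 : z.2 ∈ Set.Icc (-R) R := abs_le.1 hz.2
  simp [Set.indicator_of_mem e1, Set.indicator_of_mem e2]

/-- Integration in time over the past of the initial time. -/
theorem integral_compl_dom_mul_dt {h : Space → ℝ} (hh : LocallyIntegrable h) {η : SpaceTime → ℝ}
    (hη : ContDiff ℝ (⊤ : ℕ∞) η) (hηc : HasCompactSupport η) :
    ∫ z in domᶜ, dt η z * h z.1 = ∫ x, η (x, 0) * h x := by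
  have c1 : Continuous (dt η) := (hη.continuous_fderiv (by simp)).clm_apply continuous_const
  have hi : Integrable (fun z : SpaceTime => dt η z * h z.1) :=
    (locallyIntegrable_comp_fst hh).integrable_smul_left_of_hasCompactSupport c1
      (hηc.fderiv_apply ℝ _)
  have hdom : domᶜ = (Set.univ : Set Space) ×ˢ Set.Iic (0 : ℝ) := by
    ext z; simp [dom]
  rw [hdom, Measure.volume_eq_prod, setIntegral_prod _ (by
    rw [← Measure.volume_eq_prod]; exact hi.integrableOn), Measure.restrict_univ]
  congr 1 with x
  simp only
  rw [integral_mul_const]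
  congr 1
  have hs : ContDiff ℝ 1 (fun t : ℝ => η (x, t)) :=
    (hη.of_le (by exact_mod_cast le_top)).comp (contDiff_const.prodMk contDiff_id)
  have hsc : HasCompactSupport (fun t : ℝ => η (x, t)) := by
    refine HasCompactSupport.of_support_subset_isCompact (hηc.isCompact.image continuous_snd) ?_
    intro t ht
    exact ⟨(x, t), subset_tsupport _ ht, rfl⟩
  rw [← hsc.integral_Iic_deriv_eq hs 0]
  congr 1 with t
  have h1 : HasFDerivAt η (fderiv ℝ η (x, t)) (x, t) :=
    (hη.differentiable (by simp) _).hasFDerivAt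
  have h2 : HasDerivAt (fun t : ℝ => η (x, t)) (fderiv ℝ η (x, t) (0, 1)) t :=
    HasFDerivAt.comp_hasDerivAt (l := η) t h1 ((hasDerivAt_const t x).prodMk (hasDerivAt_id t))
  rw [h2.deriv, dt]

/-- The projection onto the symmetric traceless matrices. -/
def projQ (A : Mat) : Mat := (1 / 2 : ℝ) • (A + Aᵀ) - (A.trace / 3) • (1 : Mat)

theorem projQ_mem (A : Mat) : projQ A ∈ QTensor := by
  refine ⟨?_, ?_⟩
  · simp [projQ, add_comm]
  · simp [projQ, Matrix.trace_fin_three]; ring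

/-- The projection is orthogonal. The equation can only be tested in symmetric traceless directions,
and this moves the projection between the right-hand side and the test matrix. -/
theorem ddot_projQ_comm (A B : Mat) : ddot (projQ A) B = ddot A (projQ B) := by
  simp only [ddot, projQ, Fin.sum_univ_three, Matrix.sub_apply, Matrix.smul_apply,
    Matrix.add_apply, Matrix.transpose_apply, Matrix.trace_fin_three, smul_eq_mul, Matrix.one_apply]
  simp
  ring

theorem projQ_of_mem {A : Mat} (h : A ∈ QTensor) : projQ A = A := by
  rw [projQ, h.1, h.2]
  ext i j
  simp
  ring

theorem ddot_single (A : Mat) (i j : Fin 3) : ddot A (Matrix.single i j 1) = A i j := by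
  simp only [ddot, Matrix.single_apply, mul_ite, mul_one, mul_zero]
  rw [Finset.sum_eq_single i (fun k _ hk => by simp [hk.symm]) (by simp)]
  simp

section Solution

variable {a b c : ℝ} {u₀ : Space → Space} {Q₀ : Space → Mat} {u : SpaceTime → Space}
  {Q : SpaceTime → Mat} {Du : SpaceTime → Mat} {DQ : Fin 3 → SpaceTime → Mat}
  {D2Q : Fin 3 → Fin 3 → SpaceTime → Mat}

/-- The right-hand side of the equation for `∂_t Q`. -/
def rhsQ (a b c : ℝ) (u : SpaceTime → Space) (Q : SpaceTime → Mat) (Du : SpaceTime → Mat)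
    (DQ : Fin 3 → SpaceTime → Mat) (D2Q : Fin 3 → Fin 3 → SpaceTime → Mat) (z : SpaceTime) : Mat :=
  lap D2Q z - ∑ k, u z k • DQ k z - (Q z * vorticity (Du z) - vorticity (Du z) * Q z)
    - fLdG a b c (Q z)

/-- `Q` extended by the initial value to negative times. -/
def extQ (Q₀ : Space → Mat) (Q : SpaceTime → Mat) (z : SpaceTime) : Mat :=
  open scoped Classical in if z ∈ dom then Q z else Q₀ z.1

theorem extQ_of_mem {z : SpaceTime} (hz : z ∈ dom) : extQ Q₀ Q z = Q z := if_pos hz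

theorem extQ_of_notMem {z : SpaceTime} (hz : z ∉ dom) : extQ Q₀ Q z = Q₀ z.1 := if_neg hz

theorem locallyIntegrable_of_memLp {f : SpaceTime → ℝ} (hf : MemLp f 2 domVol) :
    LocallyIntegrable f domVol := hf.locallyIntegrable (by norm_num)

theorem locallyIntegrable_mul_of_memLp {f g : SpaceTime → ℝ} (hf : MemLp f 2 domVol)
    (hg : MemLp g 2 domVol) : LocallyIntegrable (fun z => f z * g z) domVol :=
  (MemLp.integrable_mul (p := 2) (q := 2) hf hg).locallyIntegrable

theorem locallyIntegrable_const_mul {f : SpaceTime → ℝ} {μ : Measure SpaceTime}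
    (hf : LocallyIntegrable f μ) (r : ℝ) : LocallyIntegrable (fun z => r * f z) μ := hf.smul r

theorem WeakSolutionWith.locallyIntegrable_lap (W : WeakSolutionWith a b c u₀ Q₀ u Q Du DQ D2Q)
    (i j : Fin 3) : LocallyIntegrable (fun z => lap D2Q z i j) domVol := by
  simp only [lap, Matrix.sum_apply]
  exact locallyIntegrable_finsetSum _ fun k _ => locallyIntegrable_of_memLp (W.D2Q_L2 k k i j)

theorem WeakSolutionWith.memLp_vorticity (W : WeakSolutionWith a b c u₀ Q₀ u Q Du DQ D2Q)
    (i j : Fin 3) : MemLp (fun z => vorticity (Du z) i j) 2 domVol := by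
  have := ((W.Du_L2 i j).sub (W.Du_L2 j i)).const_mul (1 / 2 : ℝ)
  simpa [vorticity] using this

theorem WeakSolutionWith.locallyIntegrable_corot (W : WeakSolutionWith a b c u₀ Q₀ u Q Du DQ D2Q)
    (i j : Fin 3) : LocallyIntegrable
      (fun z => (Q z * vorticity (Du z) - vorticity (Du z) * Q z) i j) domVol := by
  simp only [Matrix.sub_apply, Matrix.mul_apply]
  refine LocallyIntegrable.sub ?_ ?_
  · exact locallyIntegrable_finsetSum _ fun k _ =>
      locallyIntegrable_mul_of_memLp (W.Q_L2 i k) (W.memLp_vorticity k j)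
  · exact locallyIntegrable_finsetSum _ fun k _ =>
      locallyIntegrable_mul_of_memLp (W.memLp_vorticity i k) (W.Q_L2 k j)

theorem WeakSolutionWith.locallyIntegrable_advection
    (W : WeakSolutionWith a b c u₀ Q₀ u Q Du DQ D2Q) (i j : Fin 3) :
    LocallyIntegrable (fun z => (∑ k, u z k • DQ k z) i j) domVol := by
  simp only [Matrix.sum_apply, Matrix.smul_apply, smul_eq_mul]
  exact locallyIntegrable_finsetSum _ fun k _ =>
    locallyIntegrable_mul_of_memLp (W.u_L2 k) (W.DQ_L2 k i j)

theorem WeakSolutionWith.locallyIntegrable_bulk (W : WeakSolutionWith a b c u₀ Q₀ u Q Du DQ D2Q)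
    (i j : Fin 3) : LocallyIntegrable (fun z => fLdG a b c (Q z) i j) domVol := by
  have hq2 : ∀ i j, LocallyIntegrable (fun z => (Q z * Q z) i j) domVol := fun i j => by
    simp only [Matrix.mul_apply]
    exact locallyIntegrable_finsetSum _ fun k _ =>
      locallyIntegrable_mul_of_memLp (W.Q_L2 i k) (W.Q_L2 k j)
  have htr : LocallyIntegrable (fun z => (Q z * Q z).trace) domVol := by
    simp only [Matrix.trace, Matrix.diag]
    exact locallyIntegrable_finsetSum _ fun k _ => hq2 k k
  have htrq : LocallyIntegrable (fun z => (Q z * Q z).trace * Q z i j) domVol := by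
    simp only [Matrix.trace, Matrix.diag, Matrix.mul_apply, Finset.sum_mul]
    exact locallyIntegrable_finsetSum _ fun k _ => locallyIntegrable_finsetSum _ fun l _ =>
      W.locallyIntegrable_mul_mul k l l k i j
  have h := ((locallyIntegrable_const_mul (locallyIntegrable_of_memLp (W.Q_L2 i j)) a).sub
    (locallyIntegrable_const_mul ((hq2 i j).sub
      (locallyIntegrable_const_mul htr ((1 : Mat) i j / 3))) b)).add
    (locallyIntegrable_const_mul htrq c)
  refine h.congr (Eventually.of_forall fun z => ?_)
  simp only [fLdG, Pi.add_apply, Pi.sub_apply, Matrix.add_apply, Matrix.sub_apply,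
    Matrix.smul_apply, smul_eq_mul]
  ring

theorem WeakSolutionWith.locallyIntegrable_rhsQ (W : WeakSolutionWith a b c u₀ Q₀ u Q Du DQ D2Q)
    (i j : Fin 3) : LocallyIntegrable (fun z => rhsQ a b c u Q Du DQ D2Q z i j) domVol :=
  (((W.locallyIntegrable_lap i j).sub (W.locallyIntegrable_advection i j)).sub
    (W.locallyIntegrable_corot i j)).sub (W.locallyIntegrable_bulk i j)

theorem ddot_add_left (A B S : Mat) : ddot (A + B) S = ddot A S + ddot B S := by
  simp [ddot, add_mul, Finset.sum_add_distrib]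

theorem ddot_sub_left (A B S : Mat) : ddot (A - B) S = ddot A S - ddot B S := by
  simp [ddot, sub_mul, Finset.sum_sub_distrib]

theorem ddot_smul_left (A S : Mat) (r : ℝ) : ddot (r • A) S = r * ddot A S := by
  simp [ddot, mul_assoc, Finset.mul_sum]

theorem ddot_sum_left {ι : Type*} (s : Finset ι) (A : ι → Mat) (S : Mat) :
    ddot (∑ k ∈ s, A k) S = ∑ k ∈ s, ddot (A k) S := by
  simp only [← inner_toV]
  rw [← sum_inner]
  congr 1
  ext p
  simp [toV_apply, Matrix.sum_apply]

theorem memLp_ddot {α : Type*} [MeasurableSpace α] {μ : Measure α} {F : α → Mat}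
    (hF : ∀ i j, MemLp (fun z => F z i j) 2 μ) (S : Mat) : MemLp (fun z => ddot (F z) S) 2 μ := by
  unfold ddot
  exact memLp_finsetSum _ fun i _ => memLp_finsetSum _ fun j _ => (hF i j).mul_const (S i j)

/-- The tested weak form of the equation for `∂_t Q` in non-conservative form. -/
theorem WeakSolutionWith.integral_dt_mul (W : WeakSolutionWith a b c u₀ Q₀ u Q Du DQ D2Q)
    {S : Mat} (hS : S ∈ QTensor) {η : SpaceTime → ℝ} (hη : ContDiff ℝ (⊤ : ℕ∞) η)
    (hηc : HasCompactSupport η) :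
    ∫ z, dt η z * ddot (Q z) S ∂domVol + ∫ x, η (x, 0) * ddot (Q₀ x) S
      = -∫ z, η z * ddot (rhsQ a b c u Q Du DQ D2Q z) S ∂domVol := by
  have hηd : ∀ v : SpaceTime, Continuous (fun z => fderiv ℝ η z v) := fun v =>
    (hη.continuous_fderiv (by simp)).clm_apply continuous_const
  have hηdc : ∀ v : SpaceTime, HasCompactSupport (fun z => fderiv ℝ η z v) := fun v =>
    hηc.fderiv_apply ℝ v
  have hdS : ∀ (v : SpaceTime) (α β : Fin 3) (z : SpaceTime),
      fderiv ℝ (fun w => (η w • S) α β) z v = fderiv ℝ η z v * S α β := fun v α β z => by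
    simp only [Matrix.smul_apply, smul_eq_mul]
    rw [fderiv_mul_const (hη.differentiable (by simp) z)]
    simp [mul_comm]
  have hφ : IsTestQ (fun z => η z • S) := by
    refine ⟨fun z => ⟨by rw [Matrix.transpose_smul, hS.1], by rw [Matrix.trace_smul, hS.2, smul_zero]⟩,
      fun α β => ?_, ?_⟩
    · simp only [Matrix.smul_apply, smul_eq_mul]
      exact hη.mul contDiff_const
    · exact hηc.smul_right
  have hQS : MemLp (fun z => ddot (Q z) S) 2 domVol := memLp_ddot W.Q_L2 S
  have hDQS : ∀ k, MemLp (fun z => ddot (DQ k z) S) 2 domVol := fun k =>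
    memLp_ddot (W.DQ_L2 k) S
  have hη' : ∀ {h : SpaceTime → ℝ}, LocallyIntegrable h domVol →
      Integrable (fun z => η z * h z) domVol := fun hh =>
    hh.integrable_smul_left_of_hasCompactSupport hη.continuous hηc
  have i1 : Integrable (fun z => dt η z * ddot (Q z) S) domVol :=
    (locallyIntegrable_of_memLp hQS).integrable_smul_left_of_hasCompactSupport (hηd _) (hηdc _)
  have i2 : Integrable (fun z => η z * ddot (lap D2Q z) S) domVol :=
    hη' (locallyIntegrable_ddot W.locallyIntegrable_lap S)
  have i3 : ∀ k, Integrable (fun z => dx k η z * (u z k * ddot (Q z) S)) domVol := fun k =>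
    (locallyIntegrable_mul_of_memLp (W.u_L2 k) hQS).integrable_smul_left_of_hasCompactSupport
      (hηd _) (hηdc _)
  have i3' : ∀ k, Integrable (fun z => η z * (u z k * ddot (DQ k z) S)) domVol := fun k =>
    hη' (locallyIntegrable_mul_of_memLp (W.u_L2 k) (hDQS k))
  have i4 : Integrable (fun z => η z * ddot (Q z * vorticity (Du z) - vorticity (Du z) * Q z) S)
      domVol := hη' (locallyIntegrable_ddot W.locallyIntegrable_corot S)
  have i5 : Integrable (fun z => η z * ddot (fLdG a b c (Q z)) S) domVol :=
    hη' (locallyIntegrable_ddot W.locallyIntegrable_bulk S)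
  have heq := W.q_eqn (fun z => η z • S) hφ
  have hL : ∀ z, (-(∑ α, ∑ β, Q z α β * dt (fun w => (η w • S) α β) z)
        - ddot (lap D2Q z) (η z • S)
        - (∑ α, ∑ β, ∑ k, Q z α β * u z k * dx k (fun w => (η w • S) α β) z)
        + ddot (Q z * vorticity (Du z)) (η z • S)
        - ddot (vorticity (Du z) * Q z) (η z • S))
      = -(dt η z * ddot (Q z) S) - η z * ddot (lap D2Q z) S
        - (∑ k, dx k η z * (u z k * ddot (Q z) S))
        + η z * ddot (Q z * vorticity (Du z) - vorticity (Du z) * Q z) S := fun z => by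
    have e1 : ∑ α, ∑ β, Q z α β * dt (fun w => (η w • S) α β) z = dt η z * ddot (Q z) S := by
      simp only [dt, hdS, ddot, Finset.mul_sum]
      exact Finset.sum_congr rfl fun i _ => Finset.sum_congr rfl fun j _ => by ring
    have e2 : ∑ α, ∑ β, ∑ k, Q z α β * u z k * dx k (fun w => (η w • S) α β) z
        = ∑ k, dx k η z * (u z k * ddot (Q z) S) := by
      simp only [dx, hdS, ddot, Finset.mul_sum]
      rw [Finset.sum_comm' (t' := Finset.univ) (s' := fun _ => Finset.univ) (by simp)]
      simp only [Fin.sum_univ_three]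
      ring
    rw [e1, e2]
    simp only [ddot_smul_right, ddot_sub_left]
    ring
  have hR : ∀ z, ddot (fLdG a b c (Q z)) (η z • S) = η z * ddot (fLdG a b c (Q z)) S :=
    fun z => ddot_smul_right _ _ _
  have hI : ∀ x, ddot (Q₀ x) (η (x, 0) • S) = η (x, 0) * ddot (Q₀ x) S :=
    fun x => ddot_smul_right _ _ _
  simp only [hR, hI] at heq
  rw [integral_congr_ae (Eventually.of_forall hL)] at heq
  have hA : ∫ z, (-(dt η z * ddot (Q z) S) - η z * ddot (lap D2Q z) S
        - (∑ k, dx k η z * (u z k * ddot (Q z) S))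
        + η z * ddot (Q z * vorticity (Du z) - vorticity (Du z) * Q z) S) ∂domVol
      = -(∫ z, dt η z * ddot (Q z) S ∂domVol) - ∫ z, η z * ddot (lap D2Q z) S ∂domVol
        - (∑ k, ∫ z, dx k η z * (u z k * ddot (Q z) S) ∂domVol)
        + ∫ z, η z * ddot (Q z * vorticity (Du z) - vorticity (Du z) * Q z) S ∂domVol := by
    have i1' : Integrable (fun z => -(dt η z * ddot (Q z) S)) domVol := i1.neg
    have j1 : Integrable (fun z => -(dt η z * ddot (Q z) S) - η z * ddot (lap D2Q z) S) domVol :=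
      i1'.sub i2
    have j2 : Integrable (fun z => ∑ k, dx k η z * (u z k * ddot (Q z) S)) domVol :=
      integrable_finsetSum _ fun k _ => i3 k
    have j3 : Integrable (fun z => -(dt η z * ddot (Q z) S) - η z * ddot (lap D2Q z) S
        - (∑ k, dx k η z * (u z k * ddot (Q z) S))) domVol := j1.sub j2
    rw [integral_add j3 i4, integral_sub j1 j2, integral_sub i1' i2, integral_neg,
      integral_finsetSum _ fun k _ => i3 k]
  have hB : ∫ z, η z * ddot (rhsQ a b c u Q Du DQ D2Q z) S ∂domVol
      = ∫ z, η z * ddot (lap D2Q z) S ∂domVol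
        - (∑ k, ∫ z, η z * (u z k * ddot (DQ k z) S) ∂domVol)
        - ∫ z, η z * ddot (Q z * vorticity (Du z) - vorticity (Du z) * Q z) S ∂domVol
        - ∫ z, η z * ddot (fLdG a b c (Q z)) S ∂domVol := by
    have j2 : Integrable (fun z => ∑ k, η z * (u z k * ddot (DQ k z) S)) domVol :=
      integrable_finsetSum _ fun k _ => i3' k
    have j3 : Integrable (fun z => η z * ddot (lap D2Q z) S
      - ∑ k, η z * (u z k * ddot (DQ k z) S)) domVol := i2.sub j2
    have j4 : Integrable (fun z => η z * ddot (lap D2Q z) S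
      - (∑ k, η z * (u z k * ddot (DQ k z) S))
      - η z * ddot (Q z * vorticity (Du z) - vorticity (Du z) * Q z) S) domVol := j3.sub i4
    rw [← integral_finsetSum _ fun k _ => i3' k, ← integral_sub i2 j2, ← integral_sub j3 i4,
      ← integral_sub j4 i5]
    congr 1 with z
    simp only [rhsQ, ddot_sub_left, ddot_sum_left, ddot_smul_left, mul_sub, Finset.mul_sum]
  -- Transport of the linear functional `A ↦ A : S` converts the conservative term `Q u·∇η` of the
  -- weak formulation into the advective term `u·∇Q` of `rhsQ`.
  have hT := W.transport (G := fun A => inner ℝ (toV S) A) (C := ‖innerSL ℝ (toV S)‖)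
    (innerSL ℝ (toV S)).contDiff (by simp) (fun A => by
      rw [show (fun A => inner ℝ (toV S) A) = innerSL ℝ (toV S) from rfl,
        ContinuousLinearMap.fderiv]) hη hηc
  have hT' : ∀ k, ∫ z, u z k * (fderiv ℝ (fun A => inner ℝ (toV S) A) (toV (Q z)) (toV (DQ k z)) * η z
          + inner ℝ (toV S) (toV (Q z)) * dx k η z) ∂domVol
      = ∫ z, η z * (u z k * ddot (DQ k z) S) ∂domVol
        + ∫ z, dx k η z * (u z k * ddot (Q z) S) ∂domVol := fun k => by
    rw [← integral_add (i3' k) (i3 k)]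
    congr 1 with z
    rw [show (fun A => inner ℝ (toV S) A) = innerSL ℝ (toV S) from rfl,
        ContinuousLinearMap.fderiv, innerSL_apply_apply, real_inner_comm, inner_toV,
        real_inner_comm, inner_toV]
    ring
  simp only [hT', Finset.sum_add_distrib] at hT
  rw [hA] at heq
  rw [hB]
  linarith

theorem WeakSolutionWith.locallyIntegrable_extQ (W : WeakSolutionWith a b c u₀ Q₀ u Q Du DQ D2Q)
    (hQ₀ : MemH1 Q₀) (i j : Fin 3) : LocallyIntegrable (fun z => extQ Q₀ Q z i j) := by
  have h1 := locallyIntegrable_indicator_dom (locallyIntegrable_of_memLp (W.Q_L2 i j))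
  have h2 := (locallyIntegrable_comp_fst ((hQ₀.2.1 i j).locallyIntegrable (by norm_num))).indicator
    measurableSet_dom.compl
  refine (h1.add h2).congr (Eventually.of_forall fun z => ?_)
  by_cases hz : z ∈ dom
  · simp [hz, extQ_of_mem]
  · simp [hz, extQ_of_notMem]

/-- The equation for `∂_t Q`, with the initial condition, on the whole of space-time. -/
theorem WeakSolutionWith.hasWeakDeriv_extQ (W : WeakSolutionWith a b c u₀ Q₀ u Q Du DQ D2Q)
    (hQ₀ : MemH1 Q₀) (i j : Fin 3) :
    HasWeakDeriv ((0, 1) : SpaceTime) (fun z => extQ Q₀ Q z i j)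
      (fun z => dom.indicator (fun z => projQ (rhsQ a b c u Q Du DQ D2Q z)) z i j) := by
  intro η hη hηc
  -- On `QTensor`, contraction with this projected matrix unit reads off the `(i, j)` entry, while
  -- `S` remains an admissible test direction.
  set S := projQ (Matrix.single i j 1) with hS
  have hSm : S ∈ QTensor := projQ_mem _
  have h1 := W.integral_dt_mul hSm hη hηc
  have hQS : ∀ A ∈ QTensor, A i j = ddot A S := fun A hA => by
    rw [hS, ← ddot_projQ_comm, projQ_of_mem hA, ddot_single]
  have hint : Integrable (fun z => fderiv ℝ η z (0, 1) • extQ Q₀ Q z i j) :=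
    (W.locallyIntegrable_extQ hQ₀ i j).integrable_smul_left_of_hasCompactSupport
      ((hη.continuous_fderiv (by simp)).clm_apply continuous_const) (hηc.fderiv_apply ℝ _)
  rw [← integral_add_compl measurableSet_dom hint]
  have e1 : ∫ z in dom, fderiv ℝ η z (0, 1) • extQ Q₀ Q z i j
      = ∫ z, dt η z * ddot (Q z) S ∂domVol := by
    refine integral_congr_ae ?_
    filter_upwards [ae_restrict_mem measurableSet_dom, W.qTensor] with z hz hq
    rw [extQ_of_mem hz, hQS _ hq]; rfl
  -- Integrating the constant-in-time continuation over negative times produces precisely the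
  -- initial term of the weak formulation, so no singular contribution remains at `t = 0`.
  have e2 : ∫ z in domᶜ, fderiv ℝ η z (0, 1) • extQ Q₀ Q z i j
      = ∫ x, η (x, 0) * ddot (Q₀ x) S := by
    rw [← integral_compl_dom_mul_dt ((memLp_ddot hQ₀.2.1 S).locallyIntegrable (by norm_num)) hη hηc]
    refine integral_congr_ae ?_
    filter_upwards [ae_restrict_mem measurableSet_dom.compl,
      ae_restrict_of_ae (Measure.quasiMeasurePreserving_fst.ae hQ₀.1)] with z hz hq
    rw [extQ_of_notMem hz, hQS _ hq]; rfl
  rw [e1, e2, h1, neg_inj]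
  symm
  refine integral_eq_integral_domVol (fun z hz => ?_) (fun z hz => ?_)
  · beta_reduce
    rw [Set.indicator_of_mem hz, hS, ← ddot_projQ_comm, ddot_single]; rfl
  · beta_reduce
    rw [Set.indicator_of_notMem hz]; simp

end Solution

/-! ### Signs of the individual terms and the weak entropy inequality -/

theorem ddot_comm (A B : Mat) : ddot A B = ddot B A := by
  simp [ddot, mul_comm]

/-- Cyclicity of the trace: for symmetric `A` the contraction is `tr (AωA) - tr (ωAA)`. This
cancellation is specific to the corotational coupling. -/
theorem ddot_corot {A : Mat} (hA : Aᵀ = A) (G : Mat) :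
    ddot (A * vorticity G - vorticity G * A) A = 0 := by
  have h : ∀ i j, A j i = A i j := fun i j => congrFun (congrFun hA i) j
  simp only [ddot, vorticity, Matrix.sub_apply, Matrix.mul_apply, Fin.sum_univ_three,
    Matrix.smul_apply, Matrix.transpose_apply, smul_eq_mul]
  rw [h 0 1, h 0 2, h 1 2]
  ring

/-- The bulk term is coercive away from a ball. -/
theorem ddot_fLdG_nonneg {a b c : ℝ} (hc : 0 < c) {A : Mat} (hA : A ∈ QTensor)
    (hn : 1 + (|a| + |b|) / c ≤ ‖A‖) : 0 ≤ ddot (fLdG a b c A) A := by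
  have htr : (A * A).trace = ‖A‖ ^ 2 := by
    have h : ∀ i j, A j i = A i j := fun i j => congrFun (congrFun hA.1 i) j
    rw [norm_sq_eq_ddot]
    simp only [Matrix.trace_fin_three, Matrix.mul_apply, ddot, Fin.sum_univ_three]
    rw [h 0 1, h 0 2, h 1 2]
  have h1 : ddot (1 : Mat) A = 0 := by
    rw [← hA.2]
    simp [ddot, Matrix.one_apply, Matrix.trace]
  have h2 : |ddot (A * A) A| ≤ ‖A‖ ^ 3 := by
    rw [← inner_toV]
    refine (abs_real_inner_le_norm _ _).trans ?_
    rw [norm_toV, norm_toV]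
    calc ‖A * A‖ * ‖A‖ ≤ ‖A‖ * ‖A‖ * ‖A‖ :=
          mul_le_mul_of_nonneg_right (Matrix.frobenius_norm_mul A A) (norm_nonneg _)
      _ = ‖A‖ ^ 3 := by ring
  have h3 : ddot (fLdG a b c A) A
      = a * ‖A‖ ^ 2 - b * ddot (A * A) A + c * ‖A‖ ^ 2 * ‖A‖ ^ 2 := by
    rw [fLdG, ddot_add_left, ddot_sub_left, ddot_smul_left, ddot_smul_left, ddot_smul_left,
      ddot_sub_left, ddot_smul_left, h1, htr, ← norm_sq_eq_ddot]
    ring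
  have hle : b * ddot (A * A) A ≤ |b| * ‖A‖ ^ 3 := by
    refine (le_abs_self _).trans ?_
    rw [abs_mul]
    exact mul_le_mul_of_nonneg_left h2 (abs_nonneg _)
  rw [h3]
  generalize ‖A‖ = n at *
  -- The two parts of the radius play separate roles: `n ≥ 1` gives `|a| ≤ |a| n`, and `c n ≥ |a| +
  -- |b|` then gives `|a| + |b| n ≤ c n²`.
  have hn1 : 1 ≤ n := by
    have : 0 ≤ (|a| + |b|) / c := by positivity
    linarith
  have hcn : |a| + |b| ≤ c * n := by
    have h4 : (|a| + |b|) / c ≤ n := by linarith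
    rw [div_le_iff₀ hc] at h4
    linarith
  have h5 : (|a| + |b|) * n ≤ c * n * n := mul_le_mul_of_nonneg_right hcn (by linarith)
  have h6 : |a| ≤ |a| * n := le_mul_of_one_le_right (abs_nonneg _) hn1
  have h7 : 0 ≤ c * n * n - |a| - |b| * n := by linarith
  have h8 : -|a| * n ^ 2 ≤ a * n ^ 2 := mul_le_mul_of_nonneg_right (neg_abs_le a) (sq_nonneg n)
  nlinarith [mul_nonneg h7 (sq_nonneg n)]

theorem inner_single_toV (p : Fin 3 × Fin 3) (A : VMat) :
    inner ℝ (EuclideanSpace.single p (1 : ℝ)) A = A p := by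
  simp [PiLp.inner_apply]

section Solution

variable {a b c : ℝ} {u₀ : Space → Space} {Q₀ : Space → Mat} {u : SpaceTime → Space}
  {Q : SpaceTime → Mat} {Du : SpaceTime → Mat} {DQ : Fin 3 → SpaceTime → Mat}
  {D2Q : Fin 3 → Fin 3 → SpaceTime → Mat}

/-- Chain rule in time for the entropy. -/
theorem WeakSolutionWith.integral_dt_entropy (W : WeakSolutionWith a b c u₀ Q₀ u Q Du DQ D2Q)
    (hQ₀ : MemH1 Q₀) {K : ℝ} (hK : 0 ≤ K) (hM : ∀ᵐ x, ‖Q₀ x‖ ≤ K) {η : SpaceTime → ℝ}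
    (hη : ContDiff ℝ (⊤ : ℕ∞) η) (hηc : HasCompactSupport η) :
    ∫ z, dt η z * entropy √(1 + K ^ 2) (toV (Q z)) ∂domVol
      = -∫ z, η z * (weight √(1 + K ^ 2) (toV (Q z))
          * ddot (rhsQ a b c u Q Du DQ D2Q z) (Q z)) ∂domVol := by
  set r := √(1 + K ^ 2) with hr
  set D : SpaceTime → Mat := dom.indicator (fun z => projQ (rhsQ a b c u Q Du DQ D2Q z)) with hD
  have hQl : LocallyIntegrable (fun z => toV (extQ Q₀ Q z)) :=
    locallyIntegrable_toV (W.locallyIntegrable_extQ hQ₀)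
  have hDl : LocallyIntegrable (fun z => toV (D z)) := by
    refine locallyIntegrable_toV fun i j => ?_
    rw [hD, indicator_dom_apply]
    refine locallyIntegrable_indicator_dom ?_
    have := locallyIntegrable_ddot W.locallyIntegrable_rhsQ (projQ (Matrix.single i j 1))
    refine this.congr (Eventually.of_forall fun z => ?_)
    change ddot _ _ = _
    rw [← ddot_projQ_comm, ddot_single]
  have hw := hasWeakDeriv_toV hQl hDl (W.hasWeakDeriv_extQ hQ₀)
  have h1 := hw.comp hQl hDl (contDiff_entropy r)
    ((entropy_eq_zero_iff hK (0 : VMat)).2 (by simpa using hK)) (norm_fderiv_entropy_le r) η hη hηc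
  have e1 : ∫ z, fderiv ℝ η z (0, 1) • entropy r (toV (extQ Q₀ Q z))
      = ∫ z, dt η z * entropy r (toV (Q z)) ∂domVol := by
    -- For `t ≤ 0` the continuation takes the values of `Q₀`, where the entropy vanishes; hence the
    -- identity carries no initial term.
    have hM' : ∀ᵐ z : SpaceTime, ‖Q₀ z.1‖ ≤ K := Measure.quasiMeasurePreserving_fst.ae hM
    have h2 : (fun z => fderiv ℝ η z (0, 1) • entropy r (toV (extQ Q₀ Q z))) =ᵐ[volume]
        dom.indicator (fun z => dt η z * entropy r (toV (Q z))) := by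
      filter_upwards [hM'] with z hz
      by_cases hzd : z ∈ dom
      · rw [Set.indicator_of_mem hzd, extQ_of_mem hzd]; rfl
      · rw [Set.indicator_of_notMem hzd, extQ_of_notMem hzd,
          (entropy_eq_zero_iff hK _).2 (by rwa [norm_toV]), smul_zero]
    rw [integral_congr_ae h2, integral_indicator measurableSet_dom, domVol]
  have e2 : ∫ z, η z • fderiv ℝ (entropy r) (toV (extQ Q₀ Q z)) (toV (D z))
      = ∫ z, η z * (weight r (toV (Q z)) * ddot (rhsQ a b c u Q Du DQ D2Q z) (Q z)) ∂domVol := by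
    rw [integral_eq_integral_domVol (H := fun z => η z * (weight r (toV (Q z))
      * ddot (projQ (rhsQ a b c u Q Du DQ D2Q z)) (Q z)))]
    · refine integral_congr_ae ?_
      filter_upwards [W.qTensor] with z hz
      rw [ddot_projQ_comm, projQ_of_mem hz]
    · intro z hz
      rw [fderiv_entropy, inner_toV, extQ_of_mem hz, hD, Set.indicator_of_mem hz, ddot_comm]; rfl
    · intro z hz
      rw [hD, Set.indicator_of_notMem hz, toV_zero, map_zero, smul_zero]
  rw [← e1, ← e2]
  exact h1

/-- The flux of the entropy. -/
def flux (r : ℝ) (u : SpaceTime → Space) (Q : SpaceTime → Mat) (DQ : Fin 3 → SpaceTime → Mat)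
    (k : Fin 3) (z : SpaceTime) : ℝ :=
  u z k * entropy r (toV (Q z)) - weight r (toV (Q z)) * inner ℝ (toV (Q z)) (toV (DQ k z))

/-- Integration by parts is available for scalar functions, so it is applied to each component of
the entropy gradient; summing over the standard basis reassembles the Hessian quadratic form. -/
theorem sum_mul_fderiv_entropyGrad (r : ℝ) (A B : VMat) :
    ∑ p, B p * fderiv ℝ (entropyGrad r (EuclideanSpace.single p 1)) A B
      = weight' r A * inner ℝ A B ^ 2 + weight r A * ‖B‖ ^ 2 := by
  simp only [fderiv_entropyGrad, inner_single_toV]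
  have h1 : ∑ p, A p * B p = inner ℝ A B := by simp [PiLp.inner_apply, mul_comm]
  have h2 : ∑ p, B p * B p = ‖B‖ ^ 2 := by
    rw [EuclideanSpace.real_norm_sq_eq]; simp [pow_two]
  rw [← h2, pow_two, Finset.mul_sum]
  nth_rewrite 3 [← h1]
  rw [← mul_assoc, Finset.mul_sum, ← Finset.sum_add_distrib]
  exact Finset.sum_congr rfl fun p _ => by ring

theorem sum_mul_entropyGrad (r : ℝ) (A B : VMat) :
    ∑ p, B p * entropyGrad r (EuclideanSpace.single p 1) A = weight r A * inner ℝ A B := by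
  simp only [entropyGrad, inner_single_toV]
  rw [PiLp.inner_apply, Finset.mul_sum]
  refine Finset.sum_congr rfl fun p _ => ?_
  simp only [RCLike.inner_apply, conj_trivial]
  ring

theorem WeakSolutionWith.memLp_fderiv_comp (W : WeakSolutionWith a b c u₀ Q₀ u Q Du DQ D2Q)
    {G : VMat → ℝ} (hG : ContDiff ℝ (⊤ : ℕ∞) G) {C : ℝ} (hC : ∀ A, ‖fderiv ℝ G A‖ ≤ C) (k : Fin 3) :
    MemLp (fun z => fderiv ℝ G (toV (Q z)) (toV (DQ k z))) 2 domVol := by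
  have h1 : MemLp (fun z => toV (Q z)) 2 domVol := memLp_toV W.Q_L2
  have h2 : MemLp (fun z => toV (DQ k z)) 2 domVol := memLp_toV (W.DQ_L2 k)
  have hc : Continuous (fun p : VMat × VMat => fderiv ℝ G p.1 p.2) :=
    ((hG.continuous_fderiv (by simp)).comp continuous_fst).clm_apply continuous_snd
  refine MemLp.of_le_mul (c := C) h2 (hc.comp_aestronglyMeasurable (h1.1.prodMk h2.1)) ?_
  exact Eventually.of_forall fun z => ((fderiv ℝ G _).le_opNorm _).trans
    (mul_le_mul_of_nonneg_right (hC _) (norm_nonneg _))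

/-- Each term is a product of two `L²` functions, so the flux is integrable on the whole domain.
This is what later makes the spatial cutoff removable. -/
theorem WeakSolutionWith.integrable_flux (W : WeakSolutionWith a b c u₀ Q₀ u Q Du DQ D2Q) {r : ℝ}
    (hr0 : entropy r (0 : VMat) = 0) (k : Fin 3) : Integrable (flux r u Q DQ k) domVol := by
  refine Integrable.sub ?_ ?_
  · exact MemLp.integrable_mul (p := 2) (q := 2) (W.u_L2 k)
      (W.memLp_comp (contDiff_entropy r) hr0 (norm_fderiv_entropy_le r))
  · have : Integrable (fun z => ∑ p : Fin 3 × Fin 3, DQ k z p.1 p.2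
        * entropyGrad r (EuclideanSpace.single p 1) (toV (Q z))) domVol :=
      integrable_finsetSum _ fun p _ => MemLp.integrable_mul (p := 2) (q := 2)
        (W.DQ_L2 k p.1 p.2) (W.memLp_comp (contDiff_entropyGrad r _) (entropyGrad_zero r _)
          (norm_fderiv_entropyGrad_le r _))
    refine this.congr (Eventually.of_forall fun z => ?_)
    exact sum_mul_entropyGrad r (toV (Q z)) (toV (DQ k z))

/-- The dissipation produced by the Laplacian. -/
theorem WeakSolutionWith.integral_lap_le (W : WeakSolutionWith a b c u₀ Q₀ u Q Du DQ D2Q) (r : ℝ)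
    {η : SpaceTime → ℝ} (hη : ContDiff ℝ (⊤ : ℕ∞) η) (hηc : HasCompactSupport η) (hη0 : ∀ z, 0 ≤ η z) :
    Integrable (fun z => η z * (weight r (toV (Q z)) * ddot (lap D2Q z) (Q z))) domVol ∧
    ∫ z, η z * (weight r (toV (Q z)) * ddot (lap D2Q z) (Q z)) ∂domVol
      ≤ -∑ k, ∫ z, (weight r (toV (Q z)) * inner ℝ (toV (Q z)) (toV (DQ k z))) * dx k η z
          ∂domVol := by
  set Φ : Fin 3 × Fin 3 → VMat → ℝ := fun p => entropyGrad r (EuclideanSpace.single p 1) with hΦ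
  have hΦL : ∀ p, MemLp (fun z => Φ p (toV (Q z))) 2 domVol := fun p =>
    W.memLp_comp (contDiff_entropyGrad r _) (entropyGrad_zero r _) (norm_fderiv_entropyGrad_le r _)
  have hΦD : ∀ p k, MemLp (fun z => fderiv ℝ (Φ p) (toV (Q z)) (toV (DQ k z))) 2 domVol :=
    fun p k => W.memLp_fderiv_comp (contDiff_entropyGrad r _) (norm_fderiv_entropyGrad_le r _) k
  obtain ⟨B, hB⟩ := hη.continuous.bounded_above_of_compact_support hηc
  have hd : ∀ k, Continuous (dx k η) := fun k =>
    (hη.continuous_fderiv (by simp)).clm_apply continuous_const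
  have hmulη : ∀ {f g : SpaceTime → ℝ}, MemLp f 2 domVol → MemLp g 2 domVol →
      Integrable (fun z => f z * (g z * η z)) domVol := fun {f g} hf hg => by
    have := (MemLp.integrable_mul (p := 2) (q := 2) hf hg).mul_bdd
      hη.continuous.aestronglyMeasurable (Eventually.of_forall hB)
    refine this.congr (Eventually.of_forall fun z => ?_)
    simp [mul_assoc]
  have hmuld : ∀ {f g : SpaceTime → ℝ} (k : Fin 3), MemLp f 2 domVol → MemLp g 2 domVol →
      Integrable (fun z => f z * (g z * dx k η z)) domVol := fun {f g} k hf hg => by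
    obtain ⟨B', hB'⟩ := (hd k).bounded_above_of_compact_support (hηc.fderiv_apply ℝ _)
    have := (MemLp.integrable_mul (p := 2) (q := 2) hf hg).mul_bdd
      (hd k).aestronglyMeasurable (Eventually.of_forall hB')
    refine this.congr (Eventually.of_forall fun z => ?_)
    simp [mul_assoc]
  have hpt : ∀ z, η z * (weight r (toV (Q z)) * ddot (lap D2Q z) (Q z))
      = ∑ k, ∑ p : Fin 3 × Fin 3, D2Q k k z p.1 p.2 * (Φ p (toV (Q z)) * η z) := fun z => by
    have h1 : ∀ k, ∑ p : Fin 3 × Fin 3, D2Q k k z p.1 p.2 * (Φ p (toV (Q z)) * η z)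
        = η z * (weight r (toV (Q z)) * ddot (D2Q k k z) (Q z)) := fun k => by
      rw [ddot_comm, ← inner_toV, ← sum_mul_entropyGrad, Finset.mul_sum]
      refine Finset.sum_congr rfl fun p _ => ?_
      simp only [hΦ, toV_apply]
      ring
    simp only [h1, lap, ddot_sum_left, Finset.mul_sum]
  have hi : ∀ k p, Integrable (fun z => D2Q k k z p.1 p.2 * (Φ p (toV (Q z)) * η z)) domVol :=
    fun k p => hmulη (W.D2Q_L2 k k p.1 p.2) (hΦL p)
  refine ⟨(integrable_finsetSum _ fun k _ => integrable_finsetSum _ fun p _ => hi k p).congr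
    (Eventually.of_forall fun z => (hpt z).symm), ?_⟩
  rw [integral_congr_ae (Eventually.of_forall hpt),
    integral_finsetSum _ fun k _ => integrable_finsetSum _ fun p _ => hi k p,
    ← Finset.sum_neg_distrib]
  refine Finset.sum_le_sum fun k _ => ?_
  rw [integral_finsetSum _ fun p _ => hi k p]
  have h2 : ∀ p : Fin 3 × Fin 3, ∫ z, D2Q k k z p.1 p.2 * (Φ p (toV (Q z)) * η z) ∂domVol
      = -∫ z, DQ k z p.1 p.2 * (fderiv ℝ (Φ p) (toV (Q z)) (toV (DQ k z)) * η z
          + Φ p (toV (Q z)) * dx k η z) ∂domVol := fun p =>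
    W.integral_mul_comp (W.D2Q_weak k k p.1 p.2) (W.DQ_L2 k p.1 p.2) (W.D2Q_L2 k k p.1 p.2)
      (contDiff_entropyGrad r _) (entropyGrad_zero r _) (norm_fderiv_entropyGrad_le r _) hη hηc
  have hi2 : ∀ p : Fin 3 × Fin 3, Integrable (fun z => DQ k z p.1 p.2
      * (fderiv ℝ (Φ p) (toV (Q z)) (toV (DQ k z)) * η z + Φ p (toV (Q z)) * dx k η z)) domVol :=
    fun p => by
      simp only [mul_add]
      exact (hmulη (W.DQ_L2 k p.1 p.2) (hΦD p k)).add (hmuld k (W.DQ_L2 k p.1 p.2) (hΦL p))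
  simp only [h2]
  rw [Finset.sum_neg_distrib, neg_le_neg_iff, ← integral_finsetSum _ fun p _ => hi2 p]
  refine integral_mono ?_ (integrable_finsetSum _ fun p _ => hi2 p) fun z => ?_
  · have := integrable_finsetSum (μ := domVol) Finset.univ
      fun (p : Fin 3 × Fin 3) _ => hmuld k (W.DQ_L2 k p.1 p.2) (hΦL p)
    refine this.congr (Eventually.of_forall fun z => ?_)
    beta_reduce
    rw [← sum_mul_entropyGrad, Finset.sum_mul]
    refine Finset.sum_congr rfl fun p _ => ?_
    simp only [hΦ, toV_apply]
    ring
  · have h3 : ∑ p : Fin 3 × Fin 3, DQ k z p.1 p.2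
          * (fderiv ℝ (Φ p) (toV (Q z)) (toV (DQ k z)) * η z + Φ p (toV (Q z)) * dx k η z)
        = (weight' r (toV (Q z)) * inner ℝ (toV (Q z)) (toV (DQ k z)) ^ 2
            + weight r (toV (Q z)) * ‖toV (DQ k z)‖ ^ 2) * η z
          + (weight r (toV (Q z)) * inner ℝ (toV (Q z)) (toV (DQ k z))) * dx k η z := by
      rw [← sum_mul_fderiv_entropyGrad, ← sum_mul_entropyGrad, Finset.sum_mul, Finset.sum_mul,
        ← Finset.sum_add_distrib]
      refine Finset.sum_congr rfl fun p _ => ?_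
      simp only [hΦ, toV_apply]
      ring
    change _ ≤ ∑ p : Fin 3 × Fin 3, _
    rw [h3]
    -- The Hessian term is nonnegative by convexity and is discarded.
    exact le_add_of_nonneg_left (mul_nonneg (weight'_mul_sq_ge r _ _) (hη0 z))

/-- The weak entropy inequality. -/
theorem WeakSolutionWith.entropy_inequality (W : WeakSolutionWith a b c u₀ Q₀ u Q Du DQ D2Q)
    (hc : 0 < c) (hQ₀ : MemH1 Q₀) {K : ℝ} (hK : 1 + (|a| + |b|) / c ≤ K)
    (hM : ∀ᵐ x, ‖Q₀ x‖ ≤ K) {η : SpaceTime → ℝ}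
    (hη : ContDiff ℝ (⊤ : ℕ∞) η) (hηc : HasCompactSupport η) (hη0 : ∀ z, 0 ≤ η z) :
    0 ≤ ∫ z, dt η z * entropy √(1 + K ^ 2) (toV (Q z)) ∂domVol
      + ∑ k, ∫ z, flux √(1 + K ^ 2) u Q DQ k z * dx k η z ∂domVol := by
  have hK0 : 0 ≤ K := le_trans (by positivity) hK
  rw [W.integral_dt_entropy hQ₀ hK0 hM hη hηc]
  set r := √(1 + K ^ 2) with hr
  have hr0 : entropy r (0 : VMat) = 0 := (entropy_eq_zero_iff hK0 _).2 (by simpa using hK0)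
  obtain ⟨hiL, hL⟩ := W.integral_lap_le r hη hηc hη0
  obtain ⟨B, hB⟩ := hη.continuous.bounded_above_of_compact_support hηc
  have hd : ∀ k, Continuous (dx k η) := fun k =>
    (hη.continuous_fderiv (by simp)).clm_apply continuous_const
  have hmuld : ∀ {f : SpaceTime → ℝ} (k : Fin 3), Integrable f domVol →
      Integrable (fun z => f z * dx k η z) domVol := fun {f} k hf => by
    obtain ⟨B', hB'⟩ := (hd k).bounded_above_of_compact_support (hηc.fderiv_apply ℝ _)
    exact hf.mul_bdd (hd k).aestronglyMeasurable (Eventually.of_forall hB')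
  have hent := W.memLp_comp (contDiff_entropy r) hr0 (norm_fderiv_entropy_le r)
  have hentD := fun k => W.memLp_fderiv_comp (contDiff_entropy r) (norm_fderiv_entropy_le r) k
  have hiU : ∀ k, Integrable (fun z => u z k * entropy r (toV (Q z)) * dx k η z) domVol :=
    fun k => hmuld k (MemLp.integrable_mul (p := 2) (q := 2) (W.u_L2 k) hent)
  have hiA : ∀ k, Integrable (fun z => u z k
      * (weight r (toV (Q z)) * inner ℝ (toV (Q z)) (toV (DQ k z))) * η z) domVol := fun k => by
    have := (MemLp.integrable_mul (p := 2) (q := 2) (W.u_L2 k) (hentD k)).mul_bdd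
      hη.continuous.aestronglyMeasurable (Eventually.of_forall hB)
    refine this.congr (Eventually.of_forall fun z => ?_)
    simp [fderiv_entropy]
  have hT := W.transport (contDiff_entropy r) hr0 (norm_fderiv_entropy_le r) hη hηc
  have hT' : ∑ k, ∫ z, u z k * (weight r (toV (Q z)) * inner ℝ (toV (Q z)) (toV (DQ k z))) * η z
        ∂domVol = -∑ k, ∫ z, u z k * entropy r (toV (Q z)) * dx k η z ∂domVol := by
    rw [eq_neg_iff_add_eq_zero, ← Finset.sum_add_distrib, ← hT]
    refine Finset.sum_congr rfl fun k _ => ?_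
    rw [← integral_add (hiA k) (hiU k)]
    congr 1 with z
    rw [fderiv_entropy]
    ring
  have hiW : ∀ k, Integrable (fun z => (weight r (toV (Q z))
      * inner ℝ (toV (Q z)) (toV (DQ k z))) * dx k η z) domVol := fun k => by
    have := (hiU k).sub (hmuld k (W.integrable_flux hr0 k))
    refine this.congr (Eventually.of_forall fun z => ?_)
    simp only [Pi.sub_apply, flux]
    ring
  have hJ : ∑ k, ∫ z, flux r u Q DQ k z * dx k η z ∂domVol
      = ∑ k, ∫ z, u z k * entropy r (toV (Q z)) * dx k η z ∂domVol
        - ∑ k, ∫ z, (weight r (toV (Q z)) * inner ℝ (toV (Q z)) (toV (DQ k z))) * dx k η z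
          ∂domVol := by
    rw [← Finset.sum_sub_distrib]
    refine Finset.sum_congr rfl fun k _ => ?_
    rw [← integral_sub (hiU k) (hiW k)]
    congr 1 with z
    rw [flux]; ring
  -- The right-hand side is only locally integrable, but the entropy gradient has norm at most 1, so
  -- pairing with it and a compactly supported `η` stays integrable.
  have hiF : Integrable (fun z => η z * (weight r (toV (Q z))
      * ddot (rhsQ a b c u Q Du DQ D2Q z) (Q z))) domVol := by
    have h1 : LocallyIntegrable (fun z => toV (rhsQ a b c u Q Du DQ D2Q z)) domVol :=
      locallyIntegrable_toV W.locallyIntegrable_rhsQ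
    have h2 := (h1.integrable_smul_left_of_hasCompactSupport hη.continuous hηc)
    have hq : AEStronglyMeasurable (fun z => toV (Q z)) domVol := (memLp_toV W.Q_L2).1
    have hc : Continuous (fun p : VMat × VMat => fderiv ℝ (entropy r) p.1 p.2) :=
      (((contDiff_entropy r).continuous_fderiv (by simp)).comp continuous_fst).clm_apply
        continuous_snd
    refine (h2.norm).mono' ?_ (Eventually.of_forall fun z => ?_) (g := fun z => ‖_‖)
    · refine (hc.comp_aestronglyMeasurable (hq.prodMk h2.1)).congr (Eventually.of_forall fun z => ?_)
      change fderiv ℝ (entropy r) (toV (Q z)) (η z • _) = _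
      rw [map_smul, fderiv_entropy, inner_toV, ddot_comm]
      rfl
    · have : η z * (weight r (toV (Q z)) * ddot (rhsQ a b c u Q Du DQ D2Q z) (Q z))
          = fderiv ℝ (entropy r) (toV (Q z)) (η z • toV (rhsQ a b c u Q Du DQ D2Q z)) := by
        rw [map_smul, fderiv_entropy, inner_toV, ddot_comm]; rfl
      rw [this]
      refine ((fderiv ℝ (entropy r) _).le_opNorm _).trans ?_
      exact mul_le_of_le_one_left (norm_nonneg _) (norm_fderiv_entropy_le r _)
  have hF : ∫ z, η z * (weight r (toV (Q z)) * ddot (rhsQ a b c u Q Du DQ D2Q z) (Q z)) ∂domVol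
      ≤ ∫ z, η z * (weight r (toV (Q z)) * ddot (lap D2Q z) (Q z)) ∂domVol
        - ∑ k, ∫ z, u z k * (weight r (toV (Q z)) * inner ℝ (toV (Q z)) (toV (DQ k z))) * η z
          ∂domVol := by
    rw [← integral_finsetSum _ fun k _ => hiA k,
      ← integral_sub hiL (integrable_finsetSum _ fun k _ => hiA k)]
    refine integral_mono_ae hiF (hiL.sub (integrable_finsetSum _ fun k _ => hiA k)) ?_
    filter_upwards [W.qTensor] with z hz
    -- Inside the ball of radius `K` the weight vanishes; outside it the bulk term is coercive.
    have hbulk : 0 ≤ weight r (toV (Q z)) * ddot (fLdG a b c (Q z)) (Q z) := by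
      rcases le_or_gt ‖Q z‖ K with h | h
      · rw [weight_eq_zero hK0 (by rwa [norm_toV]), zero_mul]
      · exact mul_nonneg (weight_nonneg _ _) (ddot_fLdG_nonneg hc hz (hK.trans h.le))
    have hadv : ∑ k, u z k * (weight r (toV (Q z)) * inner ℝ (toV (Q z)) (toV (DQ k z))) * η z
        = η z * (weight r (toV (Q z)) * ∑ k, u z k * ddot (DQ k z) (Q z)) := by
      rw [Finset.mul_sum, Finset.mul_sum]
      refine Finset.sum_congr rfl fun k _ => ?_
      rw [inner_toV, ddot_comm]; ring
    rw [hadv, rhsQ, ddot_sub_left, ddot_sub_left, ddot_sub_left, ddot_corot hz.1, ddot_sum_left]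
    simp only [ddot_smul_left]
    nlinarith [mul_nonneg (hη0 z) hbulk]
  linarith

end Solution

/-! ### Space-time cutoffs -/

/-- A smooth cutoff in time, decreasing for positive times. -/
def timeCutoff (T t : ℝ) : ℝ := expNegInvGlue (T - t) * Real.smoothTransition (t + 2)

theorem contDiff_timeCutoff (T : ℝ) : ContDiff ℝ (⊤ : ℕ∞) (timeCutoff T) :=
  (expNegInvGlue.contDiff.comp (contDiff_const.sub contDiff_id)).mul
    (Real.smoothTransition.contDiff.comp (contDiff_id.add contDiff_const))

theorem timeCutoff_nonneg (T t : ℝ) : 0 ≤ timeCutoff T t :=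
  mul_nonneg (expNegInvGlue.nonneg _) (Real.smoothTransition.nonneg _)

theorem hasCompactSupport_timeCutoff (T : ℝ) : HasCompactSupport (timeCutoff T) := by
  refine HasCompactSupport.of_support_subset_isCompact (isCompact_Icc (a := -2) (b := T)) ?_
  intro t ht
  rw [Function.mem_support] at ht
  refine ⟨?_, ?_⟩
  · by_contra h
    exact ht (by rw [timeCutoff, Real.smoothTransition.zero_of_nonpos (by linarith), mul_zero])
  · by_contra h
    exact ht (by rw [timeCutoff, expNegInvGlue.zero_of_nonpos (by linarith), zero_mul])

/-- For positive times the rising factor is locally constant equal to 1, so only the decreasing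
factor contributes. The derivative is strictly negative for `0 < t < T`, which is what detects the
entropy. -/
theorem deriv_timeCutoff {T t : ℝ} (ht : 0 < t) :
    deriv (timeCutoff T) t = -((T - t)⁻¹ ^ 2 * expNegInvGlue (T - t)) := by
  have h := expNegInvGlue.hasDerivAt_polynomial_eval_inv_mul 1 (T - t)
  simp only [Polynomial.eval_one, one_mul, Polynomial.derivative_one, sub_zero, mul_one,
    Polynomial.eval_pow, Polynomial.eval_X] at h
  have h2 : HasDerivAt (fun t => expNegInvGlue (T - t))
      ((T - t)⁻¹ ^ 2 * expNegInvGlue (T - t) * (-1)) t :=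
    HasDerivAt.comp (h₂ := expNegInvGlue) t h ((hasDerivAt_id t).const_sub T)
  have h3 : timeCutoff T =ᶠ[𝓝 t] fun t => expNegInvGlue (T - t) := by
    filter_upwards [lt_mem_nhds ht] with s hs
    rw [timeCutoff, Real.smoothTransition.one_of_one_le (by linarith), mul_one]
  rw [h3.deriv_eq, h2.deriv]
  ring

/-- A smooth cutoff in space at scale `n + 1`. -/
def spaceCutoff (χ : ContDiffBump (0 : Space)) (n : ℕ) (x : Space) : ℝ := χ ((n + 1 : ℝ)⁻¹ • x)

theorem contDiff_spaceCutoff (χ : ContDiffBump (0 : Space)) (n : ℕ) :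
    ContDiff ℝ (⊤ : ℕ∞) (spaceCutoff χ n) := χ.contDiff.comp (contDiff_const_smul _)

theorem hasCompactSupport_spaceCutoff (χ : ContDiffBump (0 : Space)) (n : ℕ) :
    HasCompactSupport (spaceCutoff χ n) :=
  χ.hasCompactSupport.comp_homeomorph
    (Homeomorph.smulOfNeZero ((n + 1 : ℝ)⁻¹) (by positivity))

theorem fderiv_spaceCutoff (χ : ContDiffBump (0 : Space)) (n : ℕ) (x : Space) :
    fderiv ℝ (spaceCutoff χ n) x = (n + 1 : ℝ)⁻¹ • fderiv ℝ χ ((n + 1 : ℝ)⁻¹ • x) :=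
  fderiv_comp_smul _

theorem tendsto_spaceCutoff (χ : ContDiffBump (0 : Space)) (x : Space) :
    Tendsto (fun n => spaceCutoff χ n x) atTop (𝓝 1) := by
  have h1 : Tendsto (fun n : ℕ => (n + 1 : ℝ)⁻¹ • x) atTop (𝓝 0) := by
    have := (tendsto_one_div_add_atTop_nhds_zero_nat (𝕜 := ℝ)).smul_const x
    simpa using this
  have h2 := (χ.continuous.tendsto 0).comp h1
  rwa [χ.one_of_mem_closedBall (Metric.mem_closedBall_self χ.rIn_pos.le)] at h2

/-- The space-time cutoff. -/
def cutoff (χ : ContDiffBump (0 : Space)) (T : ℝ) (n : ℕ) (z : SpaceTime) : ℝ :=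
  spaceCutoff χ n z.1 * timeCutoff T z.2

theorem contDiff_cutoff (χ : ContDiffBump (0 : Space)) (T : ℝ) (n : ℕ) :
    ContDiff ℝ (⊤ : ℕ∞) (cutoff χ T n) :=
  ((contDiff_spaceCutoff χ n).comp contDiff_fst).mul ((contDiff_timeCutoff T).comp contDiff_snd)

theorem cutoff_nonneg (χ : ContDiffBump (0 : Space)) (T : ℝ) (n : ℕ) (z : SpaceTime) :
    0 ≤ cutoff χ T n z := mul_nonneg χ.nonneg (timeCutoff_nonneg _ _)

theorem hasCompactSupport_cutoff (χ : ContDiffBump (0 : Space)) (T : ℝ) (n : ℕ) :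
    HasCompactSupport (cutoff χ T n) := by
  refine HasCompactSupport.of_support_subset_isCompact
    ((hasCompactSupport_spaceCutoff χ n).isCompact.prod (hasCompactSupport_timeCutoff T).isCompact) ?_
  intro z hz
  exact ⟨subset_tsupport _ (left_ne_zero_of_mul hz), subset_tsupport _ (right_ne_zero_of_mul hz)⟩

theorem fderiv_cutoff (χ : ContDiffBump (0 : Space)) (T : ℝ) (n : ℕ) (z v : SpaceTime) :
    fderiv ℝ (cutoff χ T n) z v = spaceCutoff χ n z.1 * (deriv (timeCutoff T) z.2 * v.2)
      + timeCutoff T z.2 * fderiv ℝ (spaceCutoff χ n) z.1 v.1 := by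
  have h1 : HasFDerivAt (fun z : SpaceTime => spaceCutoff χ n z.1)
      ((fderiv ℝ (spaceCutoff χ n) z.1).comp (ContinuousLinearMap.fst ℝ Space ℝ)) z :=
    HasFDerivAt.comp (g := spaceCutoff χ n) z
      ((contDiff_spaceCutoff χ n).differentiable (by simp) _).hasFDerivAt hasFDerivAt_fst
  have h2 : HasFDerivAt (fun z : SpaceTime => timeCutoff T z.2)
      (deriv (timeCutoff T) z.2 • ContinuousLinearMap.snd ℝ Space ℝ) z :=
    HasDerivAt.comp_hasFDerivAt (h₂ := timeCutoff T) z
      ((contDiff_timeCutoff T).differentiable (by simp) _).hasDerivAt hasFDerivAt_snd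
  have h3 : HasFDerivAt (cutoff χ T n) _ z := h1.mul h2
  rw [h3.fderiv]
  simp

/-! ### Removing the cutoffs and the maximum principle -/

section Solution

variable {a b c : ℝ} {u₀ : Space → Space} {Q₀ : Space → Mat} {u : SpaceTime → Space}
  {Q : SpaceTime → Mat} {Du : SpaceTime → Mat} {DQ : Fin 3 → SpaceTime → Mat}
  {D2Q : Fin 3 → Fin 3 → SpaceTime → Mat}

theorem WeakSolutionWith.integrable_entropy (W : WeakSolutionWith a b c u₀ Q₀ u Q Du DQ D2Q) {r : ℝ}
    (hr : 1 ≤ r) : Integrable (fun z => entropy r (toV (Q z))) domVol := by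
  have h1 : MemLp (fun z => toV (Q z)) 2 domVol := memLp_toV W.Q_L2
  refine (h1.integrable_norm_pow two_ne_zero).mono'
    ((contDiff_entropy r).continuous.comp_aestronglyMeasurable h1.1) (Eventually.of_forall fun z => ?_)
  rw [Real.norm_eq_abs, abs_of_nonneg (entropy_nonneg _ _)]
  exact entropy_le hr _

/-- The entropy inequality integrated over space. -/
theorem WeakSolutionWith.integral_deriv_timeCutoff_nonneg
    (W : WeakSolutionWith a b c u₀ Q₀ u Q Du DQ D2Q)
    (hc : 0 < c) (hQ₀ : MemH1 Q₀) {K : ℝ} (hK : 1 + (|a| + |b|) / c ≤ K)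
    (hM : ∀ᵐ x, ‖Q₀ x‖ ≤ K) (T : ℝ) :
    Integrable (fun z => deriv (timeCutoff T) z.2 * entropy √(1 + K ^ 2) (toV (Q z))) domVol ∧
    0 ≤ ∫ z, deriv (timeCutoff T) z.2 * entropy √(1 + K ^ 2) (toV (Q z)) ∂domVol := by
  have hK0 : 0 ≤ K := le_trans (by positivity) hK
  set r := √(1 + K ^ 2) with hr
  have hr1 : 1 ≤ r := Real.one_le_sqrt.2 (by nlinarith)
  have hr0 : entropy r (0 : VMat) = 0 := (entropy_eq_zero_iff hK0 _).2 (by simpa using hK0)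
  have hE := W.integrable_entropy hr1
  set χ : ContDiffBump (0 : Space) := ⟨1, 2, one_pos, one_lt_two⟩
  obtain ⟨B, hB⟩ := ((χ.contDiff (n := 1)).continuous_fderiv
    (by simp)).bounded_above_of_compact_support (χ.hasCompactSupport.fderiv ℝ)
  have hτ := contDiff_timeCutoff T
  have hτd : Continuous (deriv (timeCutoff T)) := hτ.continuous_deriv (by simp)
  obtain ⟨B₁, hB₁⟩ := hτ.continuous.bounded_above_of_compact_support (hasCompactSupport_timeCutoff T)
  obtain ⟨B₂, hB₂⟩ := hτd.bounded_above_of_compact_support (hasCompactSupport_timeCutoff T).deriv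
  have hB0 : 0 ≤ B := (norm_nonneg _).trans (hB 0)
  have hB₁0 : 0 ≤ B₁ := (norm_nonneg _).trans (hB₁ 0)
  have hB₂0 : 0 ≤ B₂ := (norm_nonneg _).trans (hB₂ 0)
  have hχ1 : ∀ n x, |spaceCutoff χ n x| ≤ 1 := fun n x => by
    rw [spaceCutoff, abs_of_nonneg χ.nonneg]; exact χ.le_one
  have hdt : ∀ n z, dt (cutoff χ T n) z = spaceCutoff χ n z.1 * deriv (timeCutoff T) z.2 :=
    fun n z => by rw [dt, fderiv_cutoff]; simp
  have hdx : ∀ k n z, dx k (cutoff χ T n) z = (n + 1 : ℝ)⁻¹ * (timeCutoff T z.2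
      * fderiv ℝ χ ((n + 1 : ℝ)⁻¹ • z.1) (EuclideanSpace.single k 1)) := fun k n z => by
    rw [dx, fderiv_cutoff, fderiv_spaceCutoff]
    simp
    ring
  have hdxb : ∀ (k : Fin 3) (n : ℕ) (z : SpaceTime), |timeCutoff T z.2
      * fderiv ℝ χ ((n + 1 : ℝ)⁻¹ • z.1) (EuclideanSpace.single k 1)| ≤ B₁ * B := fun k n z => by
    rw [abs_mul]
    refine mul_le_mul (hB₁ _) ?_ (abs_nonneg _) hB₁0
    refine ((fderiv ℝ χ _).le_opNorm _).trans ?_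
    simpa using hB _
  have lim1 : Tendsto (fun n => ∫ z, dt (cutoff χ T n) z * entropy r (toV (Q z)) ∂domVol) atTop
      (𝓝 (∫ z, deriv (timeCutoff T) z.2 * entropy r (toV (Q z)) ∂domVol)) := by
    refine tendsto_integral_of_dominated_convergence (fun z => B₂ * ‖entropy r (toV (Q z))‖)
      (fun n => ?_) (hE.norm.const_mul _) (fun n => Eventually.of_forall fun z => ?_)
      (Eventually.of_forall fun z => ?_)
    · exact (((contDiff_cutoff χ T n).continuous_fderiv (by simp)).clm_apply
        continuous_const).aestronglyMeasurable.mul hE.1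
    · rw [norm_mul, hdt, norm_mul]
      refine mul_le_mul_of_nonneg_right ?_ (norm_nonneg _)
      exact (mul_le_of_le_one_left (norm_nonneg _) (hχ1 n z.1)).trans (hB₂ _)
    · simp only [hdt]
      simpa using ((tendsto_spaceCutoff χ z.1).mul_const (deriv (timeCutoff T) z.2)).mul_const
        (entropy r (toV (Q z)))
  -- The spatial gradient of the cutoff carries a factor `1 / (n + 1)`, and the flux is integrable,
  -- so no flux escapes through infinity.
  have lim2 : ∀ k, Tendsto (fun n => ∫ z, flux r u Q DQ k z * dx k (cutoff χ T n) z ∂domVol) atTop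
      (𝓝 0) := fun k => by
    have hJ := W.integrable_flux hr0 k
    have h0 : (0 : ℝ) = ∫ _z : SpaceTime, (0 : ℝ) ∂domVol := by simp
    rw [h0]
    have hinv : Tendsto (fun n : ℕ => (n + 1 : ℝ)⁻¹) atTop (𝓝 0) := by
      simpa using tendsto_one_div_add_atTop_nhds_zero_nat (𝕜 := ℝ)
    refine tendsto_integral_of_dominated_convergence (fun z => ‖flux r u Q DQ k z‖ * (B₁ * B))
      (fun n => ?_) (hJ.norm.mul_const _) (fun n => Eventually.of_forall fun z => ?_)
      (Eventually.of_forall fun z => ?_)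
    · exact hJ.1.mul (((contDiff_cutoff χ T n).continuous_fderiv (by simp)).clm_apply
        continuous_const).aestronglyMeasurable
    · rw [norm_mul, hdx, norm_mul]
      refine mul_le_mul_of_nonneg_left ?_ (norm_nonneg _)
      refine (mul_le_of_le_one_left (norm_nonneg _) ?_).trans (hdxb k n z)
      rw [norm_inv, Real.norm_eq_abs, abs_of_nonneg (by positivity)]
      exact inv_le_one_of_one_le₀ (by linarith [n.cast_nonneg (α := ℝ)])
    · refine squeeze_zero_norm (a := fun n : ℕ => ‖flux r u Q DQ k z‖ * ((n + 1 : ℝ)⁻¹ * (B₁ * B)))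
        (fun n => ?_) ?_
      · rw [norm_mul, hdx, norm_mul, norm_inv, Real.norm_eq_abs ((n : ℝ) + 1),
          abs_of_nonneg (by positivity : (0 : ℝ) ≤ n + 1)]
        refine mul_le_mul_of_nonneg_left ?_ (norm_nonneg _)
        exact mul_le_mul_of_nonneg_left (hdxb k n z) (by positivity)
      · simpa using (hinv.mul_const (B₁ * B)).const_mul ‖flux r u Q DQ k z‖
  refine ⟨?_, ?_⟩
  · refine (hE.norm.const_mul B₂).mono' ((hτd.comp continuous_snd).aestronglyMeasurable.mul hE.1)
      (Eventually.of_forall fun z => ?_)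
    rw [norm_mul]
    exact mul_le_mul_of_nonneg_right (hB₂ _) (norm_nonneg _)
  · have lim := lim1.add (tendsto_finsetSum Finset.univ fun k _ => lim2 k)
    simp only [Finset.sum_const_zero, add_zero] at lim
    exact ge_of_tendsto' lim fun n => W.entropy_inequality hc hQ₀ hK hM (contDiff_cutoff χ T n)
      (hasCompactSupport_cutoff χ T n) (cutoff_nonneg χ T n)

/-- The maximum principle. -/
theorem WeakSolutionWith.norm_le (W : WeakSolutionWith a b c u₀ Q₀ u Q Du DQ D2Q)
    (hc : 0 < c) (hQ₀ : MemH1 Q₀) {K : ℝ} (hK : 1 + (|a| + |b|) / c ≤ K)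
    (hM : ∀ᵐ x, ‖Q₀ x‖ ≤ K) : ∀ᵐ z ∂domVol, ‖Q z‖ ≤ K := by
  have hK0 : 0 ≤ K := le_trans (by positivity) hK
  have key : ∀ T : ℕ, ∀ᵐ z ∂domVol, z.2 < (T : ℝ) → ‖Q z‖ ≤ K := fun T => by
    obtain ⟨hi, h0⟩ := W.integral_deriv_timeCutoff_nonneg hc hQ₀ hK hM T
    have hneg : ∀ᵐ z ∂domVol,
        0 ≤ -(deriv (timeCutoff T) z.2 * entropy √(1 + K ^ 2) (toV (Q z))) := by
      filter_upwards [ae_restrict_mem measurableSet_dom] with z hz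
      rw [deriv_timeCutoff hz, neg_mul, neg_neg]
      exact mul_nonneg (mul_nonneg (sq_nonneg _) (expNegInvGlue.nonneg _)) (entropy_nonneg _ _)
    -- A nonpositive function with nonnegative integral vanishes almost everywhere. Before time `T`
    -- the cutoff derivative is nonzero, so the entropy must vanish there.
    have hzero : ∫ z, -(deriv (timeCutoff T) z.2 * entropy √(1 + K ^ 2) (toV (Q z))) ∂domVol = 0 :=
      le_antisymm (by rw [integral_neg]; linarith) (integral_nonneg_of_ae hneg)
    have hae := (integral_eq_zero_iff_of_nonneg_ae hneg hi.neg).1 hzero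
    filter_upwards [hae, ae_restrict_mem measurableSet_dom] with z hz hzd hzT
    have h1 : 0 < (T - z.2)⁻¹ ^ 2 * expNegInvGlue (T - z.2) := by
      have : 0 < (T : ℝ) - z.2 := by linarith
      exact mul_pos (by positivity) (expNegInvGlue.pos_of_pos this)
    rw [deriv_timeCutoff hzd, neg_mul, neg_neg] at hz
    have h2 := (mul_eq_zero.1 hz).resolve_left h1.ne'
    rwa [entropy_eq_zero_iff hK0, norm_toV] at h2
  filter_upwards [ae_all_iff.2 key] with z hz
  obtain ⟨T, hT⟩ := exists_nat_gt z.2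
  exact hz T hT

end Solution

end BerisEdwards

end

theorem lemma4p1 (a b c : ℝ) (hc : 0 < c) (M : ℝ≥0) :
    ∃ C : ℝ, 0 < C ∧
      ∀ (u₀ : BerisEdwards.Space → BerisEdwards.Space) (Q₀ : BerisEdwards.Space → BerisEdwards.Mat)
        (u : BerisEdwards.SpaceTime → BerisEdwards.Space)
        (Q : BerisEdwards.SpaceTime → BerisEdwards.Mat),
        BerisEdwards.MemH u₀ → BerisEdwards.MemH1 Q₀ →
        eLpNorm Q₀ ⊤ volume ≤ M →
        BerisEdwards.IsWeakSolution a b c u₀ Q₀ u Q →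
        ∀ᵐ z ∂BerisEdwards.domVol, ‖Q z‖ ≤ C := by
  -- The level must exceed both the radius beyond which the bulk term is coercive and the bound on
  -- the initial data.
  refine ⟨max (1 + (|a| + |b|) / c) M, lt_max_of_lt_left (by positivity), ?_⟩
  rintro u₀ Q₀ u Q - hQ₀ hM ⟨Du, DQ, D2Q, W⟩
  refine W.norm_le hc hQ₀ (le_max_left _ _) ?_
  rw [eLpNorm_exponent_top] at hM
  filter_upwards [ae_le_eLpNormEssSup (f := Q₀) (μ := volume)] with x hx
  refine le_trans ?_ (le_max_right _ _)
  have h := hx.trans hM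
  rw [← ofReal_norm, ← ENNReal.ofReal_coe_nnreal] at h
  exact (ENNReal.ofReal_le_ofReal_iff M.2).1 h
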